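/- Let $ABC$ be a nondegenerate triangle in the Euclidean plane. For a point $P$ on its circumcircle, $P\neq A,B,C$, let the P-ellipses $\mathcal{E}_a^*,\mathcal{E}_b^*,\mathcal{E}_c^*$ be the ellipses through $P$ with foci $(B,C)$, $(C,A)$, $(A,B)$, respectively, and let the V-ellipses $\mathcal{E}_a,\mathcal{E}_b,\mathcal{E}_c$ be the ellipses with foci $(B,C)$, $(C,A)$, $(A,B)$ passing through $A$, $B$, $C$, respectively. The vertices of such an ellipse are its two intersections with the line through its foci. Then, for every such $P$, there is exactly one conic $\mathcal{Y}^*$ passing through the six vertices of the three P-ellipses; it is degenerate, namely a union of two distinct straight lines, and it has exactly one center (of symmetry) $O^*$. Moreover, as $P$ moves over the circumcircle minus $\{A,B,C\}$, the locus of $O^*$ is the union of three arcs (without their endpoints), one on each of three distinct ellipses $\mathcal{L}_a,\mathcal{L}_b,\mathcal{L}_c$, each of which passes through the midpoints of the three sides of $ABC$. The two endpoints of the arc on $\mathcal{L}_a$ are one vertex of $\mathcal{E}_b$ and one vertex of $\mathcal{E}_c$, those of the arc on $\mathcal{L}_b$ are one vertex of $\mathcal{E}_c$ and one of $\mathcal{E}_a$,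 and those of the arc on $\mathcal{L}_c$ are one vertex of $\mathcal{E}_a$ and one of $\mathcal{E}_b$. -/

import Mathlib

noncomputable section

namespace ConicTriad

/-- The Euclidean plane. -/
abbrev Plane := EuclideanSpace ℝ (Fin 2)

/-- The locus of points whose distances to `F` and `G` have sum `s`. -/
def focalLocus (F G : Plane) (s : ℝ) : Set Plane :=
  {X | dist X F + dist X G = s}

/-- A (nondegenerate) ellipse, given by two foci and a sum of distances. Circles are included. -/
def IsEllipse (E : Set Plane) : Prop :=
  ∃ (F G : Plane) (s : ℝ), dist F G < s ∧ E = focalLocus F G s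

/-- The ellipse with foci `F`, `G` passing through `P` (nondegenerate if `P` is not on the
segment `FG`). -/
def ellipseThrough (F G P : Plane) : Set Plane :=
  focalLocus F G (dist P F + dist P G)

/-- The vertices of the ellipse with foci `F ≠ G` through `P`: its intersections with the
focal axis. -/
def vertices (F G P : Plane) : Set Plane :=
  ellipseThrough F G P ∩ (line[ℝ, F, G] : Set Plane)

/-- The vertices of the `i`-th V-ellipse of the triangle `T`: its foci are the two vertices of `T`
other than the `i`-th one, and it passes through the `i`-th one. -/
def vEllipseVertices (T : Affine.Triangle ℝ Plane) (i : Fin 3) : Set Plane :=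
  vertices (T.points (i + 1)) (T.points (i + 2)) (T.points i)

/-- The vertices of the `i`-th P-ellipse of the triangle `T`: its foci are the two vertices of `T`
other than the `i`-th one, and it passes through `P`. -/
def pEllipseVertices (T : Affine.Triangle ℝ Plane) (P : Plane) (i : Fin 3) : Set Plane :=
  vertices (T.points (i + 1)) (T.points (i + 2)) P

/-- A (possibly degenerate) conic: the zero set of a polynomial of degree exactly two. -/
def IsConic (Y : Set Plane) : Prop :=
  ∃ a b c d e f : ℝ, ¬ (a = 0 ∧ b = 0 ∧ c = 0) ∧
    Y = {X | a * X 0 ^ 2 + b * X 0 * X 1 + c * X 1 ^ 2 + d * X 0 + e * X 1 + f = 0}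

/-- The conic is degenerate: it is the union of two distinct straight lines. -/
def IsLinePair (Y : Set Plane) : Prop :=
  ∃ l m : AffineSubspace ℝ Plane, Module.finrank ℝ l.direction = 1 ∧
    Module.finrank ℝ m.direction = 1 ∧ l ≠ m ∧ Y = (l : Set Plane) ∪ (m : Set Plane)

/-- `O` is a center (of symmetry) of `Y`. -/
def IsCenter (Y : Set Plane) (O : Plane) : Prop :=
  ∀ X ∈ Y, AffineEquiv.pointReflection ℝ O X ∈ Y

/-- `Y` is a conic through the six vertices of the three P-ellipses of the triangle `T`. -/
def IsSixPointConic (T : Affine.Triangle ℝ Plane) (P : Plane) (Y : Set Plane) : Prop :=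
  IsConic Y ∧ ∀ i : Fin 3, pEllipseVertices T P i ⊆ Y

/-- The points of the circumcircle that are not vertices of the triangle (at a vertex of the
triangle, two of the P-ellipses collapse to segments). -/
def admissible (T : Affine.Triangle ℝ Plane) : Set Plane :=
  {P | P ∈ T.circumsphere ∧ P ∉ Set.range T.points}

/-- The locus of the center of the six-point conic as `P` moves on the circumcircle. -/
def centerLocus (T : Affine.Triangle ℝ Plane) : Set Plane :=
  {O | ∃ P ∈ admissible T, ∃ Y, IsSixPointConic T P Y ∧ IsCenter Y O}

/-- `Γ` is an arc of the curve `E` with the (distinct) endpoints `U`, `W`, which belong to `E`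
and are not counted as part of the arc. -/
def IsArc (E : Set Plane) (U W : Plane) (Γ : Set Plane) : Prop :=
  ∃ γ : ℝ → Plane, ContinuousOn γ (Set.Icc 0 1) ∧ Set.InjOn γ (Set.Icc 0 1) ∧
    Set.MapsTo γ (Set.Icc 0 1) E ∧ γ 0 = U ∧ γ 1 = W ∧ Γ = γ '' Set.Ioo 0 1

end ConicTriad

end

open ConicTriad

noncomputable section

namespace ConicTriad

/-! Write the circumcircle so that the parameter `θ` stands for central angle `2θ`; then chords have
length `2R|sin(θ - η)|`. Let the triangle have parameters `α < β < γ < α + π`, and let `P` have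
parameter `θ` in `(β, γ)`. With the half-angle tangents `p`, `q`, `t` of `θ - α`, `θ - β`, `γ - θ`,
the ratios of focal sum to focal distance are `(1 + qt)/(1 - qt)` on `BC`, `(1 + pt)/(1 - pt)` on
`CA` and `(p + q)/(p - q)` on `AB` (`exists_halfAngle_params`). So in barycentric coordinates the
six vertices are, in both orders, `1 : -qt` on `BC`, `1 : -pt` on `CA` and `p : -q` on `AB`
(`vertices_eq`).

These three ratios satisfy Menelaus' condition: the lines `q u + p v + p q t w = 0` and `p t u + q t
v + w = 0` each contain one vertex from every side. A conic through the six points must have equal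
coefficients of `u²`, `v²`, `w²`, because the points on each side are symmetric about its midpoint;
the rest of the form is then fixed up to a scalar, and it is the product of the two lines
(`conic_eq_linePair`). Its only center is their intersection, given by a cross product
(`exists_sixPointConic`).

Back in terms of `θ`, the barycentric coordinates of the center are quadratic in `cos θ`, `sin θ`
and have a constant sum (`weight_add`), hence are affine in `cos 2θ`, `sin 2θ`. The center therefore
runs over an affine image of the unit circle, that is, over an ellipse (`exists_centerCurve_eq`,
`isEllipse_trigCurve`). At the ends `θ = β`, `θ = γ` one coordinate vanishes and the center is a
vertex of a V-ellipse. The two other arcs come from the cyclic shifts `(β, γ, α + π)` and `(γ, α +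
π, β + π)`, since the circle has period `π` in `θ`. -/

lemma plane_ext {X Y : Plane} (h0 : X 0 = Y 0) (h1 : X 1 = Y 1) : X = Y := by
  ext i
  fin_cases i
  · exact h0
  · exact h1

/-! ### Affine functions and pairs of lines -/

/-- The affine function with coefficients `p`, `q`, `r`. -/
def affineFun (p q r : ℝ) (X : Plane) : ℝ := p * X 0 + q * X 1 + r

/-- The zero set of the product of two affine functions. -/
def linePair (p₁ q₁ r₁ p₂ q₂ r₂ : ℝ) : Set Plane :=
  {X | affineFun p₁ q₁ r₁ X * affineFun p₂ q₂ r₂ X = 0}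

lemma exists_affineFun_eq {p₁ q₁ p₂ q₂ : ℝ} (r₁ r₂ : ℝ) (h : p₁ * q₂ - p₂ * q₁ ≠ 0) (x y : ℝ) :
    ∃ X, affineFun p₁ q₁ r₁ X = x ∧ affineFun p₂ q₂ r₂ X = y := by
  have hi := mul_inv_cancel₀ h
  refine ⟨!₂[((x - r₁) * q₂ - (y - r₂) * q₁) * (p₁ * q₂ - p₂ * q₁)⁻¹,
    (p₁ * (y - r₂) - p₂ * (x - r₁)) * (p₁ * q₂ - p₂ * q₁)⁻¹], ?_, ?_⟩ <;>
  simp only [affineFun, Matrix.cons_val_zero, Matrix.cons_val_one]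
  · linear_combination (x - r₁) * hi
  · linear_combination (y - r₂) * hi

lemma affineFun_injective {p₁ q₁ p₂ q₂ : ℝ} {r₁ r₂ : ℝ} (h : p₁ * q₂ - p₂ * q₁ ≠ 0) {X Y : Plane}
    (h₁ : affineFun p₁ q₁ r₁ X = affineFun p₁ q₁ r₁ Y)
    (h₂ : affineFun p₂ q₂ r₂ X = affineFun p₂ q₂ r₂ Y) : X = Y := by
  simp only [affineFun] at h₁ h₂
  apply plane_ext
  · apply mul_left_cancel₀ h
    linear_combination q₂ * h₁ - q₁ * h₂
  · apply mul_left_cancel₀ h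
    linear_combination p₁ * h₂ - p₂ * h₁

lemma affineFun_pointReflection (p q r : ℝ) (O X : Plane) :
    affineFun p q r (AffineEquiv.pointReflection ℝ O X) =
      2 * affineFun p q r O - affineFun p q r X := by
  simp only [affineFun, AffineEquiv.pointReflection_apply, vsub_eq_sub, vadd_eq_add,
    PiLp.add_apply, PiLp.sub_apply]
  ring

lemma isConic_linePair {p₁ q₁ p₂ q₂ : ℝ} (r₁ r₂ : ℝ) (h : p₁ * q₂ - p₂ * q₁ ≠ 0) :
    IsConic (linePair p₁ q₁ r₁ p₂ q₂ r₂) := by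
  refine ⟨p₁ * p₂, p₁ * q₂ + p₂ * q₁, q₁ * q₂, p₁ * r₂ + p₂ * r₁, q₁ * r₂ + q₂ * r₁, r₁ * r₂,
    ?_, ?_⟩
  · rintro ⟨h₁, h₂, -⟩
    -- The square of the determinant is the discriminant of the quadratic part of the product.
    apply pow_ne_zero 2 h
    linear_combination (p₁ * q₂ + p₂ * q₁) * h₂ - 4 * q₁ * q₂ * h₁
  · ext X
    simp only [linePair, affineFun, Set.mem_ofPred_eq]
    constructor <;> intro hX <;> linear_combination hX

lemma exists_line_eq_zeros {p q r : ℝ} {O : Plane} (hpq : ¬ (p = 0 ∧ q = 0))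
    (hO : affineFun p q r O = 0) :
    ∃ l : AffineSubspace ℝ Plane, Module.finrank ℝ l.direction = 1 ∧
      (l : Set Plane) = {X | affineFun p q r X = 0} := by
  have hd : (!₂[-q, p] : Plane) ≠ 0 := by
    intro h
    have h0 := congrArg (fun X : Plane => X 0) h
    have h1 := congrArg (fun X : Plane => X 1) h
    simp at h0 h1
    exact hpq ⟨h1, h0⟩
  refine ⟨AffineSubspace.mk' O (Submodule.span ℝ {!₂[-q, p]}), ?_, ?_⟩
  · rw [AffineSubspace.direction_mk']
    exact finrank_span_singleton hd
  · ext X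
    simp only [SetLike.mem_coe, AffineSubspace.mem_mk', Submodule.mem_span_singleton,
      Set.mem_ofPred_eq]
    simp only [affineFun] at hO ⊢
    constructor
    · rintro ⟨s, hs⟩
      have h0 := congrArg (fun X : Plane => X 0) hs
      have h1 := congrArg (fun X : Plane => X 1) hs
      simp at h0 h1
      linear_combination hO - p * h0 - q * h1
    · intro hX
      have hne : p ^ 2 + q ^ 2 ≠ 0 := by
        intro h
        exact hpq ⟨by nlinarith, by nlinarith⟩
      refine ⟨(p * (X 1 - O 1) - q * (X 0 - O 0)) / (p ^ 2 + q ^ 2), ?_⟩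
      apply plane_ext
      · simp
        field_simp
        linear_combination p * (hO - hX)
      · simp
        field_simp
        linear_combination q * (hO - hX)

lemma isLinePair_linePair {p₁ q₁ p₂ q₂ : ℝ} (r₁ r₂ : ℝ) (h : p₁ * q₂ - p₂ * q₁ ≠ 0) :
    IsLinePair (linePair p₁ q₁ r₁ p₂ q₂ r₂) := by
  obtain ⟨O, h₁, h₂⟩ := exists_affineFun_eq r₁ r₂ h 0 0
  obtain ⟨l, hl, hl'⟩ := exists_line_eq_zeros (by rintro ⟨rfl, rfl⟩; simp at h) h₁
  obtain ⟨m, hm, hm'⟩ := exists_line_eq_zeros (by rintro ⟨rfl, rfl⟩; simp at h) h₂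
  refine ⟨l, m, hl, hm, ?_, ?_⟩
  · rintro rfl
    obtain ⟨X, h₃, h₄⟩ := exists_affineFun_eq r₁ r₂ h 0 1
    have hX : X ∈ (l : Set Plane) := by rw [hl']; exact h₃
    rw [hm', Set.mem_ofPred_eq, h₄] at hX
    exact one_ne_zero hX
  · rw [hl', hm']
    ext X
    simp [linePair]

lemma isCenter_linePair_iff {p₁ q₁ p₂ q₂ : ℝ} (r₁ r₂ : ℝ) (h : p₁ * q₂ - p₂ * q₁ ≠ 0) (O : Plane) :
    IsCenter (linePair p₁ q₁ r₁ p₂ q₂ r₂) O ↔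
      affineFun p₁ q₁ r₁ O = 0 ∧ affineFun p₂ q₂ r₂ O = 0 := by
  simp only [IsCenter, linePair, Set.mem_ofPred_eq, affineFun_pointReflection]
  constructor
  · intro hO
    constructor
    -- The test point lies on the first line and is chosen so that the second function equals 1 at
    -- its reflection; the first function must then vanish there.
    · obtain ⟨X, h₁, h₂⟩ := exists_affineFun_eq r₁ r₂ h 0 (2 * affineFun p₂ q₂ r₂ O - 1)
      have := hO X (by rw [h₁]; ring)
      rw [h₁, h₂] at this
      linarith
    · obtain ⟨X, h₁, h₂⟩ := exists_affineFun_eq r₁ r₂ h (2 * affineFun p₁ q₁ r₁ O - 1) 0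
      have := hO X (by rw [h₂]; ring)
      rw [h₁, h₂] at this
      linarith
  · rintro ⟨h₁, h₂⟩ X hX
    rw [h₁, h₂]
    linarith

/-! ### Barycentric coordinates -/

/-- Twice the signed area of the triangle `ABC`. -/
def cross (A B C : Plane) : ℝ := (B 0 - A 0) * (C 1 - A 1) - (B 1 - A 1) * (C 0 - A 0)

lemma exists_barycentric {A B C : Plane} (hD : cross A B C ≠ 0) (X : Plane) :
    ∃ u v w : ℝ, u + v + w = 1 ∧ X = u • A + v • B + w • C := by
  refine ⟨cross X B C / cross A B C, cross A X C / cross A B C, cross A B X / cross A B C,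
    ?_, ?_⟩
  · field_simp
    simp only [cross]
    ring
  · apply plane_ext <;> simp only [PiLp.add_apply, PiLp.smul_apply, smul_eq_mul] <;> field_simp <;>
      simp only [cross] <;> ring

lemma barycentric_injective {A B C : Plane} (hD : cross A B C ≠ 0) {u v w u' v' w' : ℝ}
    (h : u + v + w = u' + v' + w') (hX : u • A + v • B + w • C = u' • A + v' • B + w' • C) :
    u = u' ∧ v = v' ∧ w = w' := by
  have h0 := congrArg (fun X : Plane => X 0) hX
  have h1 := congrArg (fun X : Plane => X 1) hX
  simp only [PiLp.add_apply, PiLp.smul_apply, smul_eq_mul] at h0 h1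
  have hv : v = v' := by
    apply mul_left_cancel₀ hD
    simp only [cross]
    linear_combination (C 1 - A 1) * h0 - (C 0 - A 0) * h1 + (A 1 * C 0 - A 0 * C 1) * h
  have hw : w = w' := by
    apply mul_left_cancel₀ hD
    simp only [cross]
    linear_combination (B 0 - A 0) * h1 - (B 1 - A 1) * h0 + (A 0 * B 1 - A 1 * B 0) * h
  exact ⟨by linarith, hv, hw⟩

/-- An affine function is given by its values at the vertices of a triangle. -/
lemma exists_affineFun_barycentric {A B C : Plane} (hD : cross A B C ≠ 0)
    (x₁ y₁ z₁ x₂ y₂ z₂ : ℝ) :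
    ∃ p₁ q₁ r₁ p₂ q₂ r₂ : ℝ,
      (∀ u v w : ℝ, u + v + w = 1 →
        affineFun p₁ q₁ r₁ (u • A + v • B + w • C) = x₁ * u + y₁ * v + z₁ * w) ∧
      (∀ u v w : ℝ, u + v + w = 1 →
        affineFun p₂ q₂ r₂ (u • A + v • B + w • C) = x₂ * u + y₂ * v + z₂ * w) ∧
      (p₁ * q₂ - p₂ * q₁) * cross A B C =
        y₁ * z₂ - z₁ * y₂ + (z₁ * x₂ - x₁ * z₂) + (x₁ * y₂ - y₁ * x₂) := by
  have key : ∀ x y z u v w : ℝ, u + v + w = 1 →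
      affineFun ((x * (B 1 - C 1) + y * (C 1 - A 1) + z * (A 1 - B 1)) / cross A B C)
        ((x * (C 0 - B 0) + y * (A 0 - C 0) + z * (B 0 - A 0)) / cross A B C)
        ((x * (B 0 * C 1 - B 1 * C 0) + y * (C 0 * A 1 - C 1 * A 0) +
          z * (A 0 * B 1 - A 1 * B 0)) / cross A B C)
        (u • A + v • B + w • C) = x * u + y * v + z * w := by
    intro x y z u v w h
    obtain rfl : u = 1 - v - w := by linarith
    simp only [affineFun, PiLp.add_apply, PiLp.smul_apply, smul_eq_mul]
    field_simp
    simp only [cross]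
    ring
  refine ⟨_, _, _, _, _, _, key x₁ y₁ z₁, key x₂ y₂ z₂, ?_⟩
  field_simp
  simp only [cross]
  ring

/-! ### The six-point conic -/

/-- A conic through three pairs of points which are symmetric on the sides of a triangle. -/
lemma conic_eq_linePair {A B C : Plane} (hD : cross A B C ≠ 0) {p q t : ℝ} (hq : 0 < q)
    (hpq : q < p) (ht : 0 < t) (hpt : p * t < 1) {p₁ q₁ r₁ p₂ q₂ r₂ : ℝ}
    (h₁ : ∀ u v w : ℝ, u + v + w = 1 →
      affineFun p₁ q₁ r₁ (u • A + v • B + w • C) = q * u + p * v + p * q * t * w)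
    (h₂ : ∀ u v w : ℝ, u + v + w = 1 →
      affineFun p₂ q₂ r₂ (u • A + v • B + w • C) = p * t * u + q * t * v + 1 * w)
    {Y : Set Plane} (hY : IsConic Y)
    (hBC : (0 : ℝ) • A + (1 / (1 - q * t)) • B + (-(q * t) / (1 - q * t)) • C ∈ Y)
    (hCB : (0 : ℝ) • A + (-(q * t) / (1 - q * t)) • B + (1 / (1 - q * t)) • C ∈ Y)
    (hAC : (1 / (1 - p * t)) • A + (0 : ℝ) • B + (-(p * t) / (1 - p * t)) • C ∈ Y)
    (hCA : (-(p * t) / (1 - p * t)) • A + (0 : ℝ) • B + (1 / (1 - p * t)) • C ∈ Y)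
    (hAB : (p / (p - q)) • A + (-q / (p - q)) • B + (0 : ℝ) • C ∈ Y)
    (hBA : (-q / (p - q)) • A + (p / (p - q)) • B + (0 : ℝ) • C ∈ Y) :
    Y = linePair p₁ q₁ r₁ p₂ q₂ r₂ := by
  obtain ⟨a, b, c, d, e, f, hne, rfl⟩ := hY
  obtain ⟨FA, FB, FC, FAB, FBC, FCA, hF⟩ : ∃ FA FB FC FAB FBC FCA : ℝ, ∀ u v w : ℝ,
      u + v + w = 1 → ∀ X : Plane, X = u • A + v • B + w • C →
        a * X 0 ^ 2 + b * X 0 * X 1 + c * X 1 ^ 2 + d * X 0 + e * X 1 + f =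
          FA * u ^ 2 + FB * v ^ 2 + FC * w ^ 2 + FAB * (u * v) + FBC * (v * w) + FCA * (w * u) := by
    refine ⟨a * A 0 ^ 2 + b * A 0 * A 1 + c * A 1 ^ 2 + d * A 0 + e * A 1 + f,
      a * B 0 ^ 2 + b * B 0 * B 1 + c * B 1 ^ 2 + d * B 0 + e * B 1 + f,
      a * C 0 ^ 2 + b * C 0 * C 1 + c * C 1 ^ 2 + d * C 0 + e * C 1 + f,
      2 * a * A 0 * B 0 + b * (A 0 * B 1 + A 1 * B 0) + 2 * c * A 1 * B 1 + d * (A 0 + B 0) +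
        e * (A 1 + B 1) + 2 * f,
      2 * a * B 0 * C 0 + b * (B 0 * C 1 + B 1 * C 0) + 2 * c * B 1 * C 1 + d * (B 0 + C 0) +
        e * (B 1 + C 1) + 2 * f,
      2 * a * C 0 * A 0 + b * (C 0 * A 1 + C 1 * A 0) + 2 * c * C 1 * A 1 + d * (C 0 + A 0) +
        e * (C 1 + A 1) + 2 * f, ?_⟩
    rintro u v w h X rfl
    obtain rfl : u = 1 - v - w := by linarith
    simp only [PiLp.add_apply, PiLp.smul_apply, smul_eq_mul]
    ring
  have hp : 0 < p := hq.trans hpq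
  have hqt : q * t < 1 := lt_trans (mul_lt_mul_of_pos_right hpq ht) hpt
  have n₁ : 1 - q * t ≠ 0 := by linarith
  have n₂ : 1 - p * t ≠ 0 := by linarith
  have n₂' : 1 - t * p ≠ 0 := by linarith
  have n₃ : p - q ≠ 0 := by linarith
  have m₁ : 1 + q * t ≠ 0 := by positivity
  have m₂ : 1 + p * t ≠ 0 := by positivity
  rw [Set.mem_ofPred_eq, hF _ _ _ (by field_simp; ring) _ rfl] at hBC hCB hAC hCA hAB hBA
  field_simp at hBC hCB hAC hCA hAB hBA
  -- The restriction to `BC` vanishes at `(1, -qt)` and `(-qt, 1)`; the difference of the two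
  -- equations is `(FB - FC)(1 - q²t²) = 0`.
  have eBC : FB = FC := by
    apply mul_left_cancel₀ (mul_ne_zero n₁ m₁)
    linear_combination hBC - hCB
  have eCA : FA = FC := by
    apply mul_left_cancel₀ (mul_ne_zero n₂ m₂)
    linear_combination hAC - hCA
  obtain ⟨l, hl⟩ : ∃ l, ∀ X : Plane,
      a * X 0 ^ 2 + b * X 0 * X 1 + c * X 1 ^ 2 + d * X 0 + e * X 1 + f =
        l * (affineFun p₁ q₁ r₁ X * affineFun p₂ q₂ r₂ X) := by
    -- The product of the two linear forms has `p q t` as the coefficient of each of `u²`, `v²`,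
    -- `w²`.
    refine ⟨FA / (p * q * t), fun X => ?_⟩
    obtain ⟨u, v, w, hs, rfl⟩ := exists_barycentric hD X
    rw [hF u v w hs _ rfl, h₁ u v w hs, h₂ u v w hs]
    field_simp
    subst eBC eCA
    linear_combination (-u * v * t) * hAB - (v * w * p) * hBC - (w * u * q) * hAC
  have l0 : l ≠ 0 := by
    rintro rfl
    -- If `l = 0`, the quadratic polynomial is identically zero, and six values suffice to kill its
    -- leading coefficients.
    apply hne
    have e1 := hl !₂[0, 0]
    have e2 := hl !₂[1, 0]
    have e3 := hl !₂[-1, 0]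
    have e4 := hl !₂[0, 1]
    have e5 := hl !₂[0, -1]
    have e6 := hl !₂[1, 1]
    simp at e1 e2 e3 e4 e5 e6
    exact ⟨by linarith, by linarith, by linarith⟩
  ext X
  simp [linePair, hl, l0]

/-- The conic through three pairs of points which are symmetric on the sides of a triangle. -/
lemma exists_sixPointConic {A B C : Plane} (hD : cross A B C ≠ 0) {p q t : ℝ} (hq : 0 < q)
    (hpq : q < p) (ht : 0 < t) (hpt : p * t < 1) :
    ∃ Y₀ : Set Plane, IsLinePair Y₀ ∧
      (∀ O, IsCenter Y₀ O ↔
        O = (p * (1 - q ^ 2 * t ^ 2) / ((p - q) * (1 - p * t) * (1 - q * t))) • A +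
          (-q * (1 - p ^ 2 * t ^ 2) / ((p - q) * (1 - p * t) * (1 - q * t))) • B +
          (-t * (p ^ 2 - q ^ 2) / ((p - q) * (1 - p * t) * (1 - q * t))) • C) ∧
      ∀ Y, (IsConic Y ∧
        ((0 : ℝ) • A + (1 / (1 - q * t)) • B + (-(q * t) / (1 - q * t)) • C ∈ Y ∧
        (0 : ℝ) • A + (-(q * t) / (1 - q * t)) • B + (1 / (1 - q * t)) • C ∈ Y) ∧
        ((1 / (1 - p * t)) • A + (0 : ℝ) • B + (-(p * t) / (1 - p * t)) • C ∈ Y ∧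
        (-(p * t) / (1 - p * t)) • A + (0 : ℝ) • B + (1 / (1 - p * t)) • C ∈ Y) ∧
        ((p / (p - q)) • A + (-q / (p - q)) • B + (0 : ℝ) • C ∈ Y ∧
        (-q / (p - q)) • A + (p / (p - q)) • B + (0 : ℝ) • C ∈ Y)) ↔ Y = Y₀ := by
  obtain ⟨p₁, q₁, r₁, p₂, q₂, r₂, h₁, h₂, hdet⟩ :=
    exists_affineFun_barycentric hD q p (p * q * t) (p * t) (q * t) 1
  have hqt : q * t < 1 := lt_trans (mul_lt_mul_of_pos_right hpq ht) hpt
  have n₁ : 1 - q * t ≠ 0 := by linarith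
  have n₂ : 1 - p * t ≠ 0 := by linarith
  have n₃ : p - q ≠ 0 := by linarith
  have hne : p₁ * q₂ - p₂ * q₁ ≠ 0 := by
    intro h
    rw [h, zero_mul] at hdet
    -- The determinant in `hdet` factors as `(p - q)(1 - pt)(1 - qt)`, which is also the normalizing
    -- denominator of the center.
    exact mul_ne_zero (mul_ne_zero n₃ n₂) n₁ (by linear_combination -hdet)
  have hO : ∀ x y z : ℝ, x + y + z = 1 → q * x + p * y + p * q * t * z = 0 →
      p * t * x + q * t * y + 1 * z = 0 →
      ∀ O, IsCenter (linePair p₁ q₁ r₁ p₂ q₂ r₂) O ↔ O = x • A + y • B + z • C := by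
    intro x y z hs hx hy O
    rw [← h₁ x y z hs] at hx
    rw [← h₂ x y z hs] at hy
    rw [isCenter_linePair_iff r₁ r₂ hne]
    constructor
    · rintro ⟨hO₁, hO₂⟩
      exact affineFun_injective hne (hO₁.trans hx.symm) (hO₂.trans hy.symm)
    · rintro rfl
      exact ⟨hx, hy⟩
  refine ⟨linePair p₁ q₁ r₁ p₂ q₂ r₂, isLinePair_linePair r₁ r₂ hne, hO _ _ _ ?_ ?_ ?_,
    fun Y => ⟨?_, ?_⟩⟩
  · field_simp
    ring
  · field_simp
    ring
  · field_simp
    ring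
  · rintro ⟨hY, ⟨hBC, hCB⟩, ⟨hAC, hCA⟩, hAB, hBA⟩
    exact conic_eq_linePair hD hq hpq ht hpt h₁ h₂ hY hBC hCB hAC hCA hAB hBA
  · rintro rfl
    refine ⟨isConic_linePair r₁ r₂ hne, ⟨?_, ?_⟩, ⟨?_, ?_⟩, ?_, ?_⟩ <;>
    · rw [linePair, Set.mem_ofPred_eq, h₁ _ _ _ (by field_simp; ring),
        h₂ _ _ _ (by field_simp; ring)]
      field_simp
      ring

/-! ### Vertices of focal ellipses -/

lemma abs_add_abs_one_sub {t k : ℝ} (hk : 1 < k) :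
    |t| + |1 - t| = k ↔ t = (1 + k) / 2 ∨ t = (1 - k) / 2 := by
  constructor
  · intro h
    rcases abs_cases t with ⟨h₁, _⟩ | ⟨h₁, _⟩ <;> rcases abs_cases (1 - t) with ⟨h₂, _⟩ | ⟨h₂, _⟩
    · linarith
    · left; linarith
    · right; linarith
    · linarith
  · rintro (rfl | rfl)
    · rw [abs_of_nonneg (by linarith), abs_of_nonpos (by linarith)]; ring
    · rw [abs_of_nonpos (by linarith), abs_of_nonneg (by linarith)]; ring

/-- On the focal axis, the point with affine coordinate `t` has distances `|t|` and `|1 - t|` to the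
foci in units of `dist F G`, so the vertices solve `|t| + |1 - t| = k`. -/
lemma vertices_eq {F G P : Plane} (hFG : F ≠ G) {k : ℝ} (hk : 1 < k)
    (h : dist P F + dist P G = k * dist F G) :
    vertices F G P = {((1 + k) / 2) • F + ((1 - k) / 2) • G,
      ((1 - k) / 2) • F + ((1 + k) / 2) • G} := by
  have hd : 0 < dist F G := dist_pos.2 hFG
  have key : ∀ t : ℝ, AffineMap.lineMap F G t ∈ ellipseThrough F G P ↔
      t = (1 + k) / 2 ∨ t = (1 - k) / 2 := by
    intro t
    rw [ellipseThrough, focalLocus, Set.mem_ofPred_eq, h, dist_lineMap_left, dist_lineMap_right,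
      ← abs_add_abs_one_sub hk, Real.norm_eq_abs, Real.norm_eq_abs, ← add_mul]
    exact mul_left_inj' hd.ne'
  ext X
  simp only [vertices, Set.mem_inter_iff, SetLike.mem_coe,
    mem_affineSpan_pair_iff_exists_lineMap_eq, Set.mem_insert_iff, Set.mem_singleton_iff]
  constructor
  · rintro ⟨hX, t, rfl⟩
    rcases (key t).1 hX with rfl | rfl
    · right
      rw [AffineMap.lineMap_apply_module]
      congr 2; ring
    · left
      rw [AffineMap.lineMap_apply_module]
      congr 2; ring
  · rintro (rfl | rfl)
    · have e : ((1 + k) / 2) • F + ((1 - k) / 2) • G = AffineMap.lineMap F G ((1 - k) / 2) := by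
        rw [AffineMap.lineMap_apply_module]
        congr 2; ring
      rw [e]
      exact ⟨(key _).2 (Or.inr rfl), _, rfl⟩
    · have e : ((1 - k) / 2) • F + ((1 + k) / 2) • G = AffineMap.lineMap F G ((1 + k) / 2) := by
        rw [AffineMap.lineMap_apply_module]
        congr 2; ring
      rw [e]
      exact ⟨(key _).2 (Or.inl rfl), _, rfl⟩

/-! ### Affine images of the unit circle -/

lemma norm_sq_plane (X : Plane) : ‖X‖ ^ 2 = X 0 ^ 2 + X 1 ^ 2 := by
  simp [EuclideanSpace.norm_sq_eq]

lemma dist_sq_plane (X Y : Plane) : dist X Y ^ 2 = (X 0 - Y 0) ^ 2 + (X 1 - Y 1) ^ 2 := by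
  rw [dist_eq_norm, norm_sq_plane]
  simp

/-- The image of the unit circle under the affine map with center `M` and axes `U`, `V`. -/
def trigCurve (M U V : Plane) : Set Plane :=
  Set.range fun ψ : ℝ => M + Real.cos ψ • U + Real.sin ψ • V

lemma exists_cos_sin {x y : ℝ} (h : x ^ 2 + y ^ 2 = 1) : ∃ θ, Real.cos θ = x ∧ Real.sin θ = y := by
  have hz : ‖(⟨x, y⟩ : ℂ)‖ = 1 := by
    rw [← sq_eq_sq₀ (norm_nonneg _) zero_le_one, Complex.sq_norm, Complex.normSq_mk]
    linarith
  obtain ⟨θ, hθ⟩ := (Complex.norm_eq_one_iff _).1 hz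
  refine ⟨θ, ?_, ?_⟩
  · simpa [Complex.exp_ofReal_mul_I_re] using congrArg Complex.re hθ
  · simpa [Complex.exp_ofReal_mul_I_im] using congrArg Complex.im hθ

/-- Rotating the pair of conjugate half-diameters only shifts the parameter; this allows a passage
to orthogonal axes. -/
lemma trigCurve_rotate (M U V : Plane) (δ : ℝ) :
    trigCurve M (Real.cos δ • U + Real.sin δ • V) (-Real.sin δ • U + Real.cos δ • V) =
      trigCurve M U V := by
  have key : ∀ ψ : ℝ, M + Real.cos ψ • (Real.cos δ • U + Real.sin δ • V) +
      Real.sin ψ • (-Real.sin δ • U + Real.cos δ • V) =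
      M + Real.cos (ψ + δ) • U + Real.sin (ψ + δ) • V := by
    intro ψ
    rw [Real.cos_add, Real.sin_add]
    module
  ext X
  constructor
  · rintro ⟨ψ, rfl⟩
    exact ⟨ψ + δ, (key ψ).symm⟩
  · rintro ⟨ψ, rfl⟩
    refine ⟨ψ - δ, ?_⟩
    have := key (ψ - δ)
    rwa [sub_add_cancel] at this

lemma exists_coords {U V : Plane} (h : U 0 * V 1 - U 1 * V 0 ≠ 0) (M X : Plane) :
    ∃ x y : ℝ, X = M + x • U + y • V := by
  have hi := mul_inv_cancel₀ h
  refine ⟨((X 0 - M 0) * V 1 - (X 1 - M 1) * V 0) * (U 0 * V 1 - U 1 * V 0)⁻¹,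
    (U 0 * (X 1 - M 1) - U 1 * (X 0 - M 0)) * (U 0 * V 1 - U 1 * V 0)⁻¹, ?_⟩
  apply plane_ext <;> simp only [PiLp.add_apply, PiLp.smul_apply, smul_eq_mul]
  · linear_combination (M 0 - X 0) * hi
  · linear_combination (M 1 - X 1) * hi

lemma coords_injective {U V : Plane} (h : U 0 * V 1 - U 1 * V 0 ≠ 0) {M : Plane} {x y x' y' : ℝ}
    (hX : M + x • U + y • V = M + x' • U + y' • V) : x = x' ∧ y = y' := by
  have h0 := congrArg (fun X : Plane => X 0) hX
  have h1 := congrArg (fun X : Plane => X 1) hX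
  simp only [PiLp.add_apply, PiLp.smul_apply, smul_eq_mul] at h0 h1
  constructor <;> apply mul_left_cancel₀ h
  · linear_combination V 1 * h0 - V 0 * h1
  · linear_combination U 0 * h1 - U 1 * h0

/-- For orthogonal axes with semi-major axis `m` and eccentricity `e`, the focal distances are `m(1
± e cos ψ)`. -/
lemma trigCurve_eq_focalLocus {M U V : Plane} (h : U 0 * V 1 - U 1 * V 0 ≠ 0)
    (hUV : U 0 * V 0 + U 1 * V 1 = 0) {m e : ℝ} (hm : 0 < m) (he : 0 ≤ e) (he1 : e < 1)
    (hU : U 0 ^ 2 + U 1 ^ 2 = m ^ 2) (hV : V 0 ^ 2 + V 1 ^ 2 = m ^ 2 * (1 - e ^ 2)) :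
    trigCurve M U V = focalLocus (M - e • U) (M + e • U) (2 * m) := by
  have he2 : 0 < 1 - e ^ 2 := by nlinarith
  have dF : ∀ x y : ℝ, dist (M + x • U + y • V) (M - e • U) ^ 2 =
      m ^ 2 * ((x + e) ^ 2 + y ^ 2 * (1 - e ^ 2)) := by
    intro x y
    rw [dist_sq_plane]
    simp only [PiLp.add_apply, PiLp.sub_apply, PiLp.smul_apply, smul_eq_mul]
    linear_combination (x + e) ^ 2 * hU + y ^ 2 * hV + 2 * (x + e) * y * hUV
  have dG : ∀ x y : ℝ, dist (M + x • U + y • V) (M + e • U) ^ 2 =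
      m ^ 2 * ((x - e) ^ 2 + y ^ 2 * (1 - e ^ 2)) := by
    intro x y
    rw [dist_sq_plane]
    simp only [PiLp.add_apply, PiLp.smul_apply, smul_eq_mul]
    linear_combination (x - e) ^ 2 * hU + y ^ 2 * hV + 2 * (x - e) * y * hUV
  ext X
  constructor
  · rintro ⟨ψ, rfl⟩
    have hc := Real.sin_sq_add_cos_sq ψ
    have hc1 := Real.cos_le_one ψ
    have hc2 := Real.neg_one_le_cos ψ
    have e1 : dist (M + Real.cos ψ • U + Real.sin ψ • V) (M - e • U) = m * (1 + e * Real.cos ψ) := by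
      rw [← sq_eq_sq₀ dist_nonneg (mul_nonneg hm.le (by nlinarith)), dF]
      linear_combination m ^ 2 * (1 - e ^ 2) * hc
    have e2 : dist (M + Real.cos ψ • U + Real.sin ψ • V) (M + e • U) = m * (1 - e * Real.cos ψ) := by
      rw [← sq_eq_sq₀ dist_nonneg (mul_nonneg hm.le (by nlinarith)), dG]
      linear_combination m ^ 2 * (1 - e ^ 2) * hc
    change dist _ _ + dist _ _ = _
    rw [e1, e2]
    ring
  · intro hX
    obtain ⟨x, y, rfl⟩ := exists_coords h M X
    change dist _ _ + dist _ _ = _ at hX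
    have h1 := dF x y
    have h2 := dG x y
    set d₁ := dist (M + x • U + y • V) (M - e • U)
    set d₂ := dist (M + x • U + y • V) (M + e • U)
    -- The sum `d₁ + d₂ = 2m` and the difference of squares `d₁² - d₂² = 4m²ex` determine both
    -- distances.
    have h3 : d₁ - d₂ = 2 * m * e * x := by
      apply mul_left_cancel₀ (mul_pos two_pos hm).ne'
      linear_combination h1 - h2 - (d₁ - d₂) * hX
    have h4 : d₁ = m * (1 + e * x) := by linarith
    rw [h4] at h1
    have hxy : x ^ 2 + y ^ 2 = 1 := by
      apply mul_left_cancel₀ (mul_pos (pow_pos hm 2) he2).ne'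
      linear_combination -h1
    obtain ⟨ψ, h5, h6⟩ := exists_cos_sin hxy
    exact ⟨ψ, by simp only [h5, h6]⟩

lemma isEllipse_trigCurve_of_orthogonal {M U V : Plane} (h : U 0 * V 1 - U 1 * V 0 ≠ 0)
    (hUV : U 0 * V 0 + U 1 * V 1 = 0) (hle : V 0 ^ 2 + V 1 ^ 2 ≤ U 0 ^ 2 + U 1 ^ 2) :
    IsEllipse (trigCurve M U V) := by
  have hV : 0 < V 0 ^ 2 + V 1 ^ 2 := by
    by_contra hcon
    have h0 : V 0 = 0 := by nlinarith [sq_nonneg (V 0), sq_nonneg (V 1)]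
    have h1 : V 1 = 0 := by nlinarith [sq_nonneg (V 0), sq_nonneg (V 1)]
    simp [h0, h1] at h
  have hU : 0 < U 0 ^ 2 + U 1 ^ 2 := hV.trans_le hle
  have hm : 0 < ‖U‖ := by
    have := norm_sq_plane U
    rcases (norm_nonneg U).eq_or_lt with h0 | h0
    · rw [← h0] at this; linarith
    · exact h0
  have hn := norm_sq_plane U
  set n := V 0 ^ 2 + V 1 ^ 2 with hn'
  have hfrac : n / ‖U‖ ^ 2 ≤ 1 := by
    rw [div_le_one (by positivity), hn]; exact hle
  have hfrac' : 0 < n / ‖U‖ ^ 2 := by positivity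
  have he : √(1 - n / ‖U‖ ^ 2) ^ 2 = 1 - n / ‖U‖ ^ 2 := Real.sq_sqrt (by linarith)
  have he1 : √(1 - n / ‖U‖ ^ 2) < 1 := by
    rw [Real.sqrt_lt' one_pos]; linarith
  refine ⟨_, _, _, ?_, trigCurve_eq_focalLocus (M := M) h hUV hm (Real.sqrt_nonneg _) he1 hn.symm
    (by rw [he, ← hn']; field_simp; ring)⟩
  rw [dist_eq_norm]
  have e : M - √(1 - n / ‖U‖ ^ 2) • U - (M + √(1 - n / ‖U‖ ^ 2) • U) =
      (-(2 * √(1 - n / ‖U‖ ^ 2))) • U := by module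
  rw [e, norm_smul, Real.norm_eq_abs, abs_neg, abs_of_nonneg (by positivity)]
  nlinarith

/-- A nondegenerate affine image of the unit circle is an ellipse. -/
lemma isEllipse_trigCurve {M U V : Plane} (h : U 0 * V 1 - U 1 * V 0 ≠ 0) :
    IsEllipse (trigCurve M U V) := by
  obtain ⟨δ, hδ⟩ : ∃ δ : ℝ, Real.cos (2 * δ) * (2 * (U 0 * V 0 + U 1 * V 1)) +
      Real.sin (2 * δ) * (V 0 ^ 2 + V 1 ^ 2 - U 0 ^ 2 - U 1 ^ 2) = 0 := by
    set P := 2 * (U 0 * V 0 + U 1 * V 1)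
    set Q := V 0 ^ 2 + V 1 ^ 2 - U 0 ^ 2 - U 1 ^ 2
    -- The direction `(cos 2δ, sin 2δ)` has to be orthogonal to `(P, Q)`, so it is taken along `(Q,
    -- -P)`.
    refine ⟨Complex.arg ⟨Q, -P⟩ / 2, ?_⟩
    rw [mul_div_cancel₀ _ two_ne_zero]
    have h1 := Complex.norm_mul_cos_arg ⟨Q, -P⟩
    have h2 := Complex.norm_mul_sin_arg ⟨Q, -P⟩
    simp only at h1 h2
    linear_combination Real.sin (Complex.arg ⟨Q, -P⟩) * (-h1) + Real.cos (Complex.arg ⟨Q, -P⟩) * h2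
  rw [Real.cos_two_mul', Real.sin_two_mul] at hδ
  have hcs := Real.sin_sq_add_cos_sq δ
  rcases le_total
    ((-Real.sin δ • U + Real.cos δ • V) 0 ^ 2 + (-Real.sin δ • U + Real.cos δ • V) 1 ^ 2)
    ((Real.cos δ • U + Real.sin δ • V) 0 ^ 2 + (Real.cos δ • U + Real.sin δ • V) 1 ^ 2)
    with hle | hle
  · rw [← trigCurve_rotate M U V δ]
    refine isEllipse_trigCurve_of_orthogonal ?_ ?_ hle
    · simp only [PiLp.add_apply, PiLp.smul_apply, smul_eq_mul]
      intro h0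
      apply h
      linear_combination h0 - (U 0 * V 1 - U 1 * V 0) * hcs
    · simp only [PiLp.add_apply, PiLp.smul_apply, smul_eq_mul]
      linear_combination hδ / 2
  -- A further quarter turn exchanges the axes, so that the longer one comes first.
  · rw [← trigCurve_rotate M U V (δ + Real.pi / 2), Real.cos_add_pi_div_two,
      Real.sin_add_pi_div_two]
    refine isEllipse_trigCurve_of_orthogonal ?_ ?_ ?_
    · simp only [PiLp.add_apply, PiLp.smul_apply, smul_eq_mul]
      intro h0
      apply h
      linear_combination h0 - (U 0 * V 1 - U 1 * V 0) * hcs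
    · simp only [PiLp.add_apply, PiLp.smul_apply, smul_eq_mul]
      linear_combination -hδ / 2
    · simp only [PiLp.add_apply, PiLp.smul_apply, smul_eq_mul] at hle ⊢
      linarith

open Real

/-! ### Points on a circle -/

/-- The point with parameter `θ` on the circle with center `O` and radius `R`; the sign `ε` is its
orientation. The inscribed angle over the points with parameters `η`, `θ` is `θ - η`. -/
def circlePoint (O : Plane) (R ε θ : ℝ) : Plane :=
  !₂[O 0 + R * cos (2 * θ), O 1 + ε * R * sin (2 * θ)]

@[simp] lemma circlePoint_zero (O : Plane) (R ε θ : ℝ) :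
    circlePoint O R ε θ 0 = O 0 + R * cos (2 * θ) := rfl

@[simp] lemma circlePoint_one (O : Plane) (R ε θ : ℝ) :
    circlePoint O R ε θ 1 = O 1 + ε * R * sin (2 * θ) := rfl

lemma circlePoint_add_int_mul_pi (O : Plane) (R ε θ : ℝ) (n : ℤ) :
    circlePoint O R ε (θ + n * π) = circlePoint O R ε θ := by
  have e : 2 * (θ + n * π) = 2 * θ + n * (2 * π) := by ring
  simp only [circlePoint, e, cos_add_int_mul_two_pi, sin_add_int_mul_two_pi]

lemma circlePoint_add_pi (O : Plane) (R ε θ : ℝ) :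
    circlePoint O R ε (θ + π) = circlePoint O R ε θ := by
  simpa using circlePoint_add_int_mul_pi O R ε θ 1

lemma circlePoint_neg (O : Plane) (R ε θ : ℝ) :
    circlePoint O R (-ε) (-θ) = circlePoint O R ε θ := by
  simp [circlePoint]

lemma cos_two_mul_sub_cos_two_mul (x y : ℝ) :
    cos (2 * x) - cos (2 * y) = -2 * sin (x + y) * sin (x - y) := by
  rw [cos_sub_cos]
  ring_nf

lemma sin_two_mul_sub_sin_two_mul (x y : ℝ) :
    sin (2 * x) - sin (2 * y) = 2 * cos (x + y) * sin (x - y) := by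
  rw [sin_sub_sin]
  ring_nf

lemma dist_circlePoint {O : Plane} {R ε : ℝ} (hR : 0 ≤ R) (hε : ε ^ 2 = 1) (θ η : ℝ) :
    dist (circlePoint O R ε θ) (circlePoint O R ε η) = 2 * R * |sin (θ - η)| := by
  rw [← sq_eq_sq₀ dist_nonneg (by positivity), dist_sq_plane, mul_pow, sq_abs]
  have h1 := cos_two_mul_sub_cos_two_mul θ η
  have h2 := sin_two_mul_sub_sin_two_mul θ η
  have h3 := sin_sq_add_cos_sq (θ + η)
  simp only [circlePoint_zero, circlePoint_one]
  have e1 : O 0 + R * cos (2 * θ) - (O 0 + R * cos (2 * η)) =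
      R * (-2 * sin (θ + η) * sin (θ - η)) := by rw [← h1]; ring
  have e2 : O 1 + ε * R * sin (2 * θ) - (O 1 + ε * R * sin (2 * η)) =
      ε * R * (2 * cos (θ + η) * sin (θ - η)) := by rw [← h2]; ring
  rw [e1, e2]
  linear_combination 4 * R ^ 2 * sin (θ - η) ^ 2 * h3 +
    4 * R ^ 2 * cos (θ + η) ^ 2 * sin (θ - η) ^ 2 * hε

lemma dist_circlePoint_of_le {O : Plane} {R ε : ℝ} (hR : 0 ≤ R) (hε : ε ^ 2 = 1) {θ η : ℝ}
    (h : η ≤ θ) (h' : θ ≤ η + π) :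
    dist (circlePoint O R ε θ) (circlePoint O R ε η) = 2 * R * sin (θ - η) := by
  rw [dist_circlePoint hR hε,
    abs_of_nonneg (sin_nonneg_of_nonneg_of_le_pi (by linarith) (by linarith))]

lemma cross_circlePoint (O : Plane) (R ε α β γ : ℝ) :
    cross (circlePoint O R ε α) (circlePoint O R ε β) (circlePoint O R ε γ) =
      4 * ε * R ^ 2 * (sin (β - α) * sin (γ - β) * sin (γ - α)) := by
  have h1 := cos_two_mul_sub_cos_two_mul β α
  have h2 := sin_two_mul_sub_sin_two_mul γ α
  have h3 := cos_two_mul_sub_cos_two_mul γ α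
  have h4 := sin_two_mul_sub_sin_two_mul β α
  have h5 : sin (γ - β) = sin (γ + α) * cos (β + α) - cos (γ + α) * sin (β + α) := by
    rw [← sin_sub]; ring_nf
  have e : cross (circlePoint O R ε α) (circlePoint O R ε β) (circlePoint O R ε γ) =
      ε * R ^ 2 * ((cos (2 * β) - cos (2 * α)) * (sin (2 * γ) - sin (2 * α)) -
        (sin (2 * β) - sin (2 * α)) * (cos (2 * γ) - cos (2 * α))) := by
    simp only [cross, circlePoint_zero, circlePoint_one]
    ring
  rw [e, h1, h2, h3, h4, h5]
  ring

lemma exists_eq_circlePoint {O X : Plane} {R ε : ℝ} (hR : 0 < R) (hε : ε ^ 2 = 1)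
    (hX : dist X O = R) (α : ℝ) :
    ∃ θ, α ≤ θ ∧ θ < α + π ∧ X = circlePoint O R ε θ := by
  have h := dist_sq_plane X O
  rw [hX] at h
  obtain ⟨η, h1, h2⟩ : ∃ η, cos η = (X 0 - O 0) / R ∧ sin η = ε * (X 1 - O 1) / R := by
    apply exists_cos_sin
    field_simp
    linear_combination (X 1 - O 1) ^ 2 * hε - h
  have key : X = circlePoint O R ε (η / 2) := by
    apply plane_ext
    · rw [circlePoint_zero, mul_div_cancel₀ _ two_ne_zero, h1]
      field_simp
      ring
    · rw [circlePoint_one, mul_div_cancel₀ _ two_ne_zero, h2]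
      field_simp
      rw [hε]
      ring
  have hmem := toIcoMod_mem_Ico pi_pos α (η / 2)
  refine ⟨toIcoMod pi_pos α (η / 2), hmem.1, hmem.2, ?_⟩
  rw [key, ← circlePoint_add_int_mul_pi O R ε (toIcoMod _ _ _) (toIcoDiv pi_pos α (η / 2))]
  congr 1
  have := toIcoMod_add_toIcoDiv_zsmul pi_pos α (η / 2)
  rw [zsmul_eq_mul] at this
  exact this.symm

/-! ### The curve of centers -/

/-- The unnormalized first barycentric coordinate of the center. -/
def weightA (α β γ θ : ℝ) : ℝ := (cos (θ - β) + cos (θ - γ)) * sin (θ - α)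

/-- The unnormalized second barycentric coordinate of the center. -/
def weightB (α β γ θ : ℝ) : ℝ := -(cos (θ - γ) + cos (θ - α)) * sin (θ - β)

/-- The unnormalized third barycentric coordinate of the center. -/
def weightC (α β γ θ : ℝ) : ℝ := (cos (θ - β) - cos (θ - α)) * sin (θ - γ)

/-- The sum of the unnormalized barycentric coordinates of the center. -/
def weightSum (α β γ : ℝ) : ℝ := sin (β - α) + sin (γ - α) - sin (γ - β)

/-- The products pair up into sines of differences such as `(θ - α) - (θ - β)`, from which `θ` drops
out. -/
lemma weight_add (α β γ θ : ℝ) :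
    weightA α β γ θ + weightB α β γ θ + weightC α β γ θ = weightSum α β γ := by
  have h1 : sin (β - α) = sin (θ - α) * cos (θ - β) - cos (θ - α) * sin (θ - β) := by
    rw [← sin_sub]; ring_nf
  have h2 : sin (γ - α) = sin (θ - α) * cos (θ - γ) - cos (θ - α) * sin (θ - γ) := by
    rw [← sin_sub]; ring_nf
  have h3 : sin (γ - β) = sin (θ - β) * cos (θ - γ) - cos (θ - β) * sin (θ - γ) := by
    rw [← sin_sub]; ring_nf
  rw [weightA, weightB, weightC, weightSum, h1, h2, h3]
  ring

lemma weightSum_pos {α β γ : ℝ} (h₁ : α < β) (h₂ : β < γ) (h₃ : γ < α + π) :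
    0 < weightSum α β γ := by
  have e : weightSum α β γ = 4 * cos ((γ - α) / 2) * sin ((β - α) / 2) * cos ((γ - β) / 2) := by
    have e1 : sin (γ - α) = 2 * sin ((γ - α) / 2) * cos ((γ - α) / 2) := by
      rw [← sin_two_mul]; ring_nf
    have e2 : sin (β - α) - sin (γ - β) =
        2 * sin ((β - α) / 2 - (γ - β) / 2) * cos ((γ - α) / 2) := by
      rw [sin_sub_sin]; ring_nf
    have e3 : (γ - α) / 2 = (β - α) / 2 + (γ - β) / 2 := by ring
    have e4 : sin ((γ - α) / 2) =
        sin ((β - α) / 2) * cos ((γ - β) / 2) + cos ((β - α) / 2) * sin ((γ - β) / 2) := by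
      rw [e3, sin_add]
    rw [sin_sub ((β - α) / 2)] at e2
    rw [weightSum]
    linear_combination e1 + e2 + 2 * cos ((γ - α) / 2) * e4
  rw [e]
  have p1 : 0 < cos ((γ - α) / 2) := cos_pos_of_mem_Ioo ⟨by linarith, by linarith⟩
  have p2 : 0 < cos ((γ - β) / 2) := cos_pos_of_mem_Ioo ⟨by linarith, by linarith⟩
  have p3 : 0 < sin ((β - α) / 2) := sin_pos_of_pos_of_lt_pi (by linarith) (by linarith)
  positivity

/-- The center of the six-point conic for the triangle with parameters `α`, `β`, `γ` and a point
with parameter `θ` between `β` and `γ`. -/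
def centerCurve (K : ℝ → Plane) (α β γ θ : ℝ) : Plane :=
  (weightA α β γ θ / weightSum α β γ) • K α + (weightB α β γ θ / weightSum α β γ) • K β +
    (weightC α β γ θ / weightSum α β γ) • K γ

lemma weight_div_add {α β γ : ℝ} (h : weightSum α β γ ≠ 0) (θ : ℝ) :
    weightA α β γ θ / weightSum α β γ + weightB α β γ θ / weightSum α β γ +
      weightC α β γ θ / weightSum α β γ = 1 := by
  rw [← add_div, ← add_div, weight_add, div_self h]

/-- Product-to-sum formula; it makes the weights affine in `cos 2θ` and `sin 2θ`. -/
lemma cos_sub_mul_sin_sub (θ b a : ℝ) : cos (θ - b) * sin (θ - a) =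
    (sin (2 * θ) * cos (a + b) - cos (2 * θ) * sin (a + b) + sin (b - a)) / 2 := by
  have e1 : sin (2 * θ) * cos (a + b) - cos (2 * θ) * sin (a + b) =
      sin ((θ - a) + (θ - b)) := by
    rw [← sin_sub]; ring_nf
  have e2 : sin (b - a) = sin ((θ - a) - (θ - b)) := by ring_nf
  rw [e1, e2, sin_add, sin_sub (θ - a)]
  ring

/-- The curve of centers is a nondegenerate affine image of the unit circle. -/
lemma exists_centerCurve_eq {K : ℝ → Plane} {α β γ : ℝ} (hS : weightSum α β γ ≠ 0)
    (hD : cross (K α) (K β) (K γ) ≠ 0) :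
    ∃ M U V : Plane, U 0 * V 1 - U 1 * V 0 ≠ 0 ∧
      ∀ θ, centerCurve K α β γ θ = M + cos (2 * θ) • U + sin (2 * θ) • V := by
  set S := weightSum α β γ with hSdef
  refine ⟨((sin (β - α) + sin (γ - α)) / 2 / S) • K α +
      (-(sin (γ - β) + sin (α - β)) / 2 / S) • K β +
      ((sin (β - γ) - sin (α - γ)) / 2 / S) • K γ,
    (-(sin (α + β) + sin (α + γ)) / 2 / S) • K α +
      ((sin (β + γ) + sin (α + β)) / 2 / S) • K β +
      ((sin (α + γ) - sin (β + γ)) / 2 / S) • K γ,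
    ((cos (α + β) + cos (α + γ)) / 2 / S) • K α +
      (-(cos (β + γ) + cos (α + β)) / 2 / S) • K β +
      ((cos (β + γ) - cos (α + γ)) / 2 / S) • K γ, ?_, fun θ => ?_⟩
  · intro h
    apply hD
    simp only [PiLp.add_apply, PiLp.smul_apply, smul_eq_mul] at h
    field_simp at h
    have h1 : sin (β - α) = sin (β + γ) * cos (α + γ) - cos (β + γ) * sin (α + γ) := by
      rw [← sin_sub]; ring_nf
    have h2 : sin (γ - α) = sin (β + γ) * cos (α + β) - cos (β + γ) * sin (α + β) := by
      rw [← sin_sub]; ring_nf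
    have h3 : sin (γ - β) = sin (α + γ) * cos (α + β) - cos (α + γ) * sin (α + β) := by
      rw [← sin_sub]; ring_nf
    -- With the sines expanded, `S` times the area is a constant multiple of the numerator of the
    -- determinant of `U`, `V`.
    rw [weightSum, h1, h2, h3] at hSdef
    apply mul_left_cancel₀ hS
    rw [hSdef, cross]
    linear_combination -h
  · have w1 : weightA α β γ θ = (sin (β - α) + sin (γ - α)) / 2 +
        cos (2 * θ) * (-(sin (α + β) + sin (α + γ)) / 2) +
        sin (2 * θ) * ((cos (α + β) + cos (α + γ)) / 2) := by
      rw [weightA, add_mul, cos_sub_mul_sin_sub, cos_sub_mul_sin_sub]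
      ring
    have w2 : weightB α β γ θ = -(sin (γ - β) + sin (α - β)) / 2 +
        cos (2 * θ) * ((sin (β + γ) + sin (α + β)) / 2) +
        sin (2 * θ) * (-(cos (β + γ) + cos (α + β)) / 2) := by
      rw [weightB, neg_mul, add_mul, cos_sub_mul_sin_sub, cos_sub_mul_sin_sub, add_comm β α]
      ring
    have w3 : weightC α β γ θ = (sin (β - γ) - sin (α - γ)) / 2 +
        cos (2 * θ) * ((sin (α + γ) - sin (β + γ)) / 2) +
        sin (2 * θ) * ((cos (β + γ) - cos (α + γ)) / 2) := by
      rw [weightC, sub_mul, cos_sub_mul_sin_sub, cos_sub_mul_sin_sub, add_comm γ β, add_comm γ α]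
      ring
    rw [centerCurve, w1, w2, w3]
    module

section Curve

variable {K : ℝ → Plane} {α β γ : ℝ}

lemma isEllipse_range_centerCurve (hS : weightSum α β γ ≠ 0)
    (hD : cross (K α) (K β) (K γ) ≠ 0) : IsEllipse (Set.range (centerCurve K α β γ)) := by
  obtain ⟨M, U, V, hUV, h⟩ := exists_centerCurve_eq hS hD
  have e : Set.range (centerCurve K α β γ) = trigCurve M U V := by
    ext X
    constructor
    · rintro ⟨θ, rfl⟩
      exact ⟨2 * θ, (h θ).symm⟩
    · rintro ⟨ψ, rfl⟩
      refine ⟨ψ / 2, ?_⟩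
      rw [h, mul_div_cancel₀ _ two_ne_zero]
  rw [e]
  exact isEllipse_trigCurve hUV

lemma centerCurve_add_int_mul_pi (hS : weightSum α β γ ≠ 0)
    (hD : cross (K α) (K β) (K γ) ≠ 0) (θ : ℝ) (n : ℤ) :
    centerCurve K α β γ (θ + n * π) = centerCurve K α β γ θ := by
  obtain ⟨M, U, V, hUV, h⟩ := exists_centerCurve_eq hS hD
  have e : 2 * (θ + n * π) = 2 * θ + n * (2 * π) := by ring
  rw [h, h, e, cos_add_int_mul_two_pi, sin_add_int_mul_two_pi]

lemma continuous_centerCurve : Continuous (centerCurve K α β γ) := by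
  unfold centerCurve weightA weightB weightC
  fun_prop

/-- Equal points have equal `cos 2θ` and `sin 2θ`, so their parameters differ by a multiple of `π`,
while the interval is shorter than `π`. -/
lemma injOn_centerCurve (hS : weightSum α β γ ≠ 0) (hD : cross (K α) (K β) (K γ) ≠ 0)
    (h₂ : γ < β + π) : Set.InjOn (centerCurve K α β γ) (Set.Icc β γ) := by
  obtain ⟨M, U, V, hUV, h⟩ := exists_centerCurve_eq hS hD
  intro x hx y hy hxy
  rw [h, h] at hxy
  obtain ⟨hc, hs⟩ := coords_injective hUV hxy
  have h0 : sin (x - y) = 0 := by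
    have e1 := cos_two_mul_sub_cos_two_mul x y
    have e2 := sin_two_mul_sub_sin_two_mul x y
    rw [hc, sub_self] at e1
    rw [hs, sub_self] at e2
    have e3 := sin_sq_add_cos_sq (x + y)
    linear_combination -sin (x - y) * e3 - cos (x + y) / 2 * e2 + sin (x + y) / 2 * e1
  have := (sin_eq_zero_iff_of_lt_of_lt (by linarith [hx.1, hy.2]) (by linarith [hx.2, hy.1])).1 h0
  linarith

lemma isArc_centerCurve (hS : weightSum α β γ ≠ 0) (hD : cross (K α) (K β) (K γ) ≠ 0)
    (h₁ : β < γ) (h₂ : γ < β + π) :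
    IsArc (Set.range (centerCurve K α β γ)) (centerCurve K α β γ β) (centerCurve K α β γ γ)
      (centerCurve K α β γ '' Set.Ioo β γ) := by
  have hpos : 0 < γ - β := sub_pos.2 h₁
  refine ⟨fun t => centerCurve K α β γ ((γ - β) * t + β), ?_, ?_, ?_, ?_, ?_, ?_⟩
  · exact (continuous_centerCurve.comp (by fun_prop)).continuousOn
  · intro x hx y hy hxy
    have hm : ∀ t ∈ Set.Icc (0 : ℝ) 1, (γ - β) * t + β ∈ Set.Icc β γ := by
      intro t ht
      constructor <;> nlinarith [ht.1, ht.2]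
    have := injOn_centerCurve hS hD h₂ (hm x hx) (hm y hy) hxy
    exact mul_left_cancel₀ hpos.ne' (by linarith)
  · intro t _
    exact ⟨_, rfl⟩
  · simp
  · simp
  · have e : Set.Ioo β γ = (fun t => (γ - β) * t + β) '' Set.Ioo 0 1 := by
      rw [Set.image_affine_Ioo hpos]
      simp
    rw [e, Set.image_image]

lemma half_div_of_add_eq {x y : ℝ} (hx : x ≠ 0) (h : y + y = x) : y / x = 1 / 2 := by
  rw [div_eq_div_iff hx two_ne_zero]
  linarith

lemma midpoint_eq_half_smul (X Y : Plane) :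
    midpoint ℝ X Y = (1 / 2 : ℝ) • X + (1 / 2 : ℝ) • Y := by
  rw [midpoint_eq_smul_add, smul_add]
  norm_num

lemma midpoint_AB_mem (hS : weightSum α β γ ≠ 0) :
    midpoint ℝ (K α) (K β) ∈ Set.range (centerCurve K α β γ) := by
  refine ⟨(α + β) / 2, ?_⟩
  have e1 : (α + β) / 2 - β = -((α + β) / 2 - α) := by ring
  have hC : weightC α β γ ((α + β) / 2) = 0 := by
    rw [weightC, e1, cos_neg]; ring
  have hAB : weightA α β γ ((α + β) / 2) = weightB α β γ ((α + β) / 2) := by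
    rw [weightA, weightB, e1, cos_neg, sin_neg]; ring
  have hs := weight_add α β γ ((α + β) / 2)
  rw [hC, hAB, add_zero] at hs
  rw [centerCurve, hC, hAB, half_div_of_add_eq hS hs, midpoint_eq_half_smul]
  simp

/-- The shift by `π / 2` is needed because `weightA` contains a sum of cosines, whereas `weightC`,
which vanishes at the midpoint of `AB`, contains a difference. -/
lemma midpoint_BC_mem (hS : weightSum α β γ ≠ 0) :
    midpoint ℝ (K β) (K γ) ∈ Set.range (centerCurve K α β γ) := by
  refine ⟨(β + γ) / 2 + π / 2, ?_⟩
  set θ := (β + γ) / 2 + π / 2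
  have e1 : θ - γ = π - (θ - β) := by simp only [θ]; ring
  have hA : weightA α β γ θ = 0 := by
    rw [weightA, e1, cos_pi_sub]; ring
  have hBC : weightB α β γ θ = weightC α β γ θ := by
    rw [weightB, weightC, e1, cos_pi_sub, sin_pi_sub]; ring
  have hs := weight_add α β γ θ
  rw [hA, hBC, zero_add] at hs
  rw [centerCurve, hA, hBC, half_div_of_add_eq hS hs, midpoint_eq_half_smul]
  simp

lemma midpoint_CA_mem (hS : weightSum α β γ ≠ 0) :
    midpoint ℝ (K γ) (K α) ∈ Set.range (centerCurve K α β γ) := by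
  refine ⟨(γ + α) / 2 + π / 2, ?_⟩
  set θ := (γ + α) / 2 + π / 2
  have e1 : θ - γ = π - (θ - α) := by simp only [θ]; ring
  have hB : weightB α β γ θ = 0 := by
    rw [weightB, e1, cos_pi_sub]; ring
  have hAC : weightA α β γ θ = weightC α β γ θ := by
    rw [weightA, weightC, e1, cos_pi_sub, sin_pi_sub]; ring
  have hs := weight_add α β γ θ
  rw [hB, hAC, add_zero] at hs
  rw [centerCurve, hB, hAC, half_div_of_add_eq hS hs, midpoint_eq_half_smul]
  simp [add_comm]

/-- The curve of centers meets the line through the first two vertices only in the midpoint and in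
the endpoint of the arc. -/
lemma centerCurve_eq_on_side (hS : weightSum α β γ ≠ 0) (hD : cross (K α) (K β) (K γ) ≠ 0)
    (hαβ : sin (β - α) ≠ 0) {θ x : ℝ} (h : centerCurve K α β γ θ = x • K α + (1 - x) • K β) :
    x = 1 / 2 ∨ centerCurve K α β γ θ = centerCurve K α β γ γ := by
  have h' : centerCurve K α β γ θ = x • K α + (1 - x) • K β + (0 : ℝ) • K γ := by
    rw [h, zero_smul, add_zero]
  rw [centerCurve] at h'
  obtain ⟨hA, hB, hC⟩ := barycentric_injective hD (by rw [weight_div_add hS]; ring) h'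
  have hC0 : weightC α β γ θ = 0 := by
    rcases div_eq_zero_iff.1 hC with h0 | h0
    · exact h0
    · exact absurd h0 hS
  rw [weightC] at hC0
  rcases mul_eq_zero.1 hC0 with h0 | h0
  · left
    have hcos : cos (θ - β) = cos (θ - α) := sub_eq_zero.1 h0
    have hsin : sin (θ - β) = -sin (θ - α) := by
      have h1 := sin_sq_add_cos_sq (θ - α)
      have h2 := sin_sq_add_cos_sq (θ - β)
      rw [hcos] at h2
      rcases sq_eq_sq_iff_eq_or_eq_neg.1 (show sin (θ - β) ^ 2 = sin (θ - α) ^ 2 by linarith)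
        with h3 | h3
      · exfalso
        apply hαβ
        have : sin (β - α) = sin (θ - α) * cos (θ - β) - cos (θ - α) * sin (θ - β) := by
          rw [← sin_sub]; ring_nf
        rw [this, hcos, h3]
        ring
      · exact h3
    have : weightA α β γ θ = weightB α β γ θ := by
      rw [weightA, weightB, hcos, hsin]; ring
    rw [this] at hA
    linarith
  · right
    obtain ⟨n, hn⟩ := sin_eq_zero_iff.1 h0
    have : θ = γ + n * π := by linarith
    rw [this, centerCurve_add_int_mul_pi hS hD]

end Curve

/-! ### Half-angle parameters -/

lemma sin_eq_tan_half {x : ℝ} (h : cos (x / 2) ≠ 0) :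
    sin x = 2 * tan (x / 2) / (1 + tan (x / 2) ^ 2) := by
  have e : sin x = 2 * sin (x / 2) * cos (x / 2) := by rw [← sin_two_mul]; ring_nf
  have hs := sin_sq_add_cos_sq (x / 2)
  rw [e, tan_eq_sin_div_cos]
  field_simp
  rw [add_comm, hs]
  ring

lemma cos_eq_tan_half {x : ℝ} (h : cos (x / 2) ≠ 0) :
    cos x = (1 - tan (x / 2) ^ 2) / (1 + tan (x / 2) ^ 2) := by
  have e : cos x = cos (x / 2) ^ 2 - sin (x / 2) ^ 2 := by rw [← cos_two_mul']; ring_nf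
  have hs := sin_sq_add_cos_sq (x / 2)
  rw [e, tan_eq_sin_div_cos]
  field_simp
  rw [add_comm (cos (x / 2) ^ 2) (sin (x / 2) ^ 2), hs]
  ring

/-- Sum-to-product gives `(sin x + sin y) / sin (x + y) = cos ((x - y)/2) / cos ((x + y)/2)`, which
is a function of the product of the half-angle tangents; for `AB` the difference `x - y` occurs
instead and gives `(p + q)/(p - q)`. The ends `θ = β`, `θ = γ` are allowed, since they yield the
endpoints of the arc. -/
lemma exists_halfAngle_params {O : Plane} {R ε : ℝ} (hR : 0 < R) (hε : ε ^ 2 = 1) {α β γ θ : ℝ}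
    (h₁ : α < β) (h₂ : β < γ) (h₃ : γ < α + π) (hβθ : β ≤ θ) (hθγ : θ ≤ γ) :
    ∃ p q t : ℝ, 0 ≤ q ∧ q < p ∧ 0 ≤ t ∧ p * t < 1 ∧ (q = 0 ↔ θ = β) ∧ (t = 0 ↔ θ = γ) ∧
      dist (circlePoint O R ε θ) (circlePoint O R ε β) +
        dist (circlePoint O R ε θ) (circlePoint O R ε γ) =
        (1 + q * t) / (1 - q * t) * dist (circlePoint O R ε β) (circlePoint O R ε γ) ∧
      dist (circlePoint O R ε θ) (circlePoint O R ε γ) +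
        dist (circlePoint O R ε θ) (circlePoint O R ε α) =
        (1 + p * t) / (1 - p * t) * dist (circlePoint O R ε γ) (circlePoint O R ε α) ∧
      dist (circlePoint O R ε θ) (circlePoint O R ε α) +
        dist (circlePoint O R ε θ) (circlePoint O R ε β) =
        (p + q) / (p - q) * dist (circlePoint O R ε α) (circlePoint O R ε β) ∧
      weightA α β γ θ / weightSum α β γ =
        p * (1 - q ^ 2 * t ^ 2) / ((p - q) * (1 - p * t) * (1 - q * t)) ∧
      weightB α β γ θ / weightSum α β γ =
        -q * (1 - p ^ 2 * t ^ 2) / ((p - q) * (1 - p * t) * (1 - q * t)) ∧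
      weightC α β γ θ / weightSum α β γ =
        -t * (p ^ 2 - q ^ 2) / ((p - q) * (1 - p * t) * (1 - q * t)) := by
  have ca : 0 < cos ((θ - α) / 2) := cos_pos_of_mem_Ioo ⟨by linarith, by linarith⟩
  have cb : 0 < cos ((θ - β) / 2) := cos_pos_of_mem_Ioo ⟨by linarith, by linarith⟩
  have cc : 0 < cos ((γ - θ) / 2) := cos_pos_of_mem_Ioo ⟨by linarith, by linarith⟩
  have sa := sin_eq_tan_half ca.ne'
  have sb := sin_eq_tan_half cb.ne'
  have sc := sin_eq_tan_half cc.ne'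
  have ka := cos_eq_tan_half ca.ne'
  have kb := cos_eq_tan_half cb.ne'
  have kc := cos_eq_tan_half cc.ne'
  have hpq : tan ((θ - β) / 2) < tan ((θ - α) / 2) :=
    tan_lt_tan_of_nonneg_of_lt_pi_div_two (by linarith) (by linarith) (by linarith)
  -- This amounts to `cos ((γ - α) / 2) > 0`.
  have hpt : tan ((θ - α) / 2) * tan ((γ - θ) / 2) < 1 := by
    rw [tan_eq_sin_div_cos, tan_eq_sin_div_cos, div_mul_div_comm, div_lt_one (by positivity)]
    have : 0 < cos ((θ - α) / 2 + (γ - θ) / 2) := cos_pos_of_mem_Ioo ⟨by linarith, by linarith⟩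
    rw [cos_add] at this
    linarith
  have hq : 0 ≤ tan ((θ - β) / 2) := tan_nonneg_of_nonneg_of_le_pi_div_two (by linarith)
    (by linarith)
  have ht : 0 ≤ tan ((γ - θ) / 2) := tan_nonneg_of_nonneg_of_le_pi_div_two (by linarith)
    (by linarith)
  have hq0 : tan ((θ - β) / 2) = 0 ↔ θ = β := by
    constructor
    · intro h
      by_contra hne
      have := tan_pos_of_pos_of_lt_pi_div_two
        (x := (θ - β) / 2) (by linarith [lt_of_le_of_ne hβθ (Ne.symm hne)]) (by linarith)
      linarith
    · rintro rfl
      simp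
  have ht0 : tan ((γ - θ) / 2) = 0 ↔ θ = γ := by
    constructor
    · intro h
      by_contra hne
      have := tan_pos_of_pos_of_lt_pi_div_two
        (x := (γ - θ) / 2) (by linarith [lt_of_le_of_ne hθγ hne]) (by linarith)
      linarith
    · rintro rfl
      simp
  refine ⟨tan ((θ - α) / 2), tan ((θ - β) / 2), tan ((γ - θ) / 2), hq, hpq, ht, hpt, hq0, ht0, ?_⟩
  generalize tan ((θ - α) / 2) = p at *
  generalize tan ((θ - β) / 2) = q at *
  generalize tan ((γ - θ) / 2) = t at *
  have hqt : q * t < 1 := (mul_le_mul_of_nonneg_right hpq.le ht).trans_lt hpt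
  have n₁ : 1 - q * t ≠ 0 := by linarith
  have n₂ : 1 - p * t ≠ 0 := by linarith
  have n₂' : 1 - t * p ≠ 0 := by linarith
  have n₃ : p - q ≠ 0 := by linarith
  have m₁ : 1 + p ^ 2 ≠ 0 := by positivity
  have m₂ : 1 + q ^ 2 ≠ 0 := by positivity
  have m₃ : 1 + t ^ 2 ≠ 0 := by positivity
  have eγβ : sin (γ - β) = 2 * (q + t) * (1 - q * t) / ((1 + q ^ 2) * (1 + t ^ 2)) := by
    have : sin (γ - β) = sin (γ - θ) * cos (θ - β) + cos (γ - θ) * sin (θ - β) := by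
      rw [← sin_add]; ring_nf
    rw [this, sb, sc, kb, kc]
    field_simp
    ring
  have eγα : sin (γ - α) = 2 * (p + t) * (1 - p * t) / ((1 + p ^ 2) * (1 + t ^ 2)) := by
    have : sin (γ - α) = sin (γ - θ) * cos (θ - α) + cos (γ - θ) * sin (θ - α) := by
      rw [← sin_add]; ring_nf
    rw [this, sa, sc, ka, kc]
    field_simp
    ring
  have eβα : sin (β - α) = 2 * (p - q) * (1 + p * q) / ((1 + p ^ 2) * (1 + q ^ 2)) := by
    have : sin (β - α) = sin (θ - α) * cos (θ - β) - cos (θ - α) * sin (θ - β) := by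
      rw [← sin_sub]; ring_nf
    rw [this, sa, sb, ka, kb]
    field_simp
    ring
  have eS : weightSum α β γ = 4 * ((p - q) * (1 - p * t) * (1 - q * t)) /
      ((1 + p ^ 2) * (1 + q ^ 2) * (1 + t ^ 2)) := by
    rw [weightSum, eγβ, eγα, eβα]
    field_simp
    ring
  have kc' : cos (θ - γ) = (1 - t ^ 2) / (1 + t ^ 2) := by rw [← kc, ← cos_neg]; ring_nf
  have sc' : sin (θ - γ) = -(2 * t / (1 + t ^ 2)) := by rw [← sc, ← sin_neg]; ring_nf
  have hne : (p - q) * (1 - p * t) * (1 - q * t) ≠ 0 := mul_ne_zero (mul_ne_zero n₃ n₂) n₁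
  have dA := dist_circlePoint_of_le (O := O) hR.le hε (h₁.le.trans hβθ) (by linarith)
  have dB := dist_circlePoint_of_le (O := O) hR.le hε hβθ (by linarith)
  have dC := dist_circlePoint_of_le (O := O) hR.le hε hθγ (by linarith)
  have dBA := dist_circlePoint_of_le (O := O) hR.le hε h₁.le (by linarith)
  have dCB := dist_circlePoint_of_le (O := O) hR.le hε h₂.le (by linarith)
  have dCA := dist_circlePoint_of_le (O := O) hR.le hε (h₁.trans h₂).le (by linarith)
  rw [dist_comm] at dC dBA dCB
  rw [dA, dB, dC, dBA, dCB, dCA, eγβ, eγα, eβα, sa, sb, sc]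
  refine ⟨?_, ?_, ?_, ?_, ?_, ?_⟩
  · field_simp
    ring
  · field_simp
    ring
  · field_simp
    ring
  · rw [weightA, sa, kb, kc', eS, div_eq_div_iff (by positivity) hne]
    field_simp
    ring
  · rw [weightB, sb, ka, kc', eS, div_eq_div_iff (by positivity) hne]
    field_simp
    ring
  · rw [weightC, sc', ka, kb, eS, div_eq_div_iff (by positivity) hne]
    field_simp
    ring

/-- `Y` is a conic through the vertices of the three ellipses through `P` whose foci are two of
the points `A`, `B`, `C`. -/
def IsSixPointConicOf (A B C P : Plane) (Y : Set Plane) : Prop :=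
  IsConic Y ∧ vertices B C P ⊆ Y ∧ vertices C A P ⊆ Y ∧ vertices A B P ⊆ Y

lemma isSixPointConicOf_rotate {A B C P : Plane} {Y : Set Plane} :
    IsSixPointConicOf B C A P Y ↔ IsSixPointConicOf A B C P Y := by
  unfold IsSixPointConicOf
  tauto

lemma one_lt_one_add_div_one_sub {x : ℝ} (h0 : 0 < x) (h1 : x < 1) : 1 < (1 + x) / (1 - x) := by
  rw [one_lt_div (by linarith)]
  linarith

lemma one_lt_add_div_sub {p q : ℝ} (hq : 0 < q) (hpq : q < p) : 1 < (p + q) / (p - q) := by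
  rw [one_lt_div (by linarith)]
  linarith

/-! ### The six-point conic and the arc endpoints for points on the circle -/

section Circle

variable {O : Plane} {R ε α β γ : ℝ}

lemma cross_circlePoint_ne_zero (hR : 0 < R) (hε : ε ^ 2 = 1) (h₁ : α < β) (h₂ : β < γ)
    (h₃ : γ < α + π) :
    cross (circlePoint O R ε α) (circlePoint O R ε β) (circlePoint O R ε γ) ≠ 0 := by
  have hε0 : ε ≠ 0 := by rintro rfl; norm_num at hε
  have s1 : 0 < sin (β - α) := sin_pos_of_pos_of_lt_pi (by linarith) (by linarith)
  have s2 : 0 < sin (γ - β) := sin_pos_of_pos_of_lt_pi (by linarith) (by linarith)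
  have s3 : 0 < sin (γ - α) := sin_pos_of_pos_of_lt_pi (by linarith) (by linarith)
  rw [cross_circlePoint]
  positivity

lemma circlePoint_ne (hR : 0 < R) (hε : ε ^ 2 = 1) {θ η : ℝ} (h : η < θ) (h' : θ < η + π) :
    circlePoint O R ε θ ≠ circlePoint O R ε η := by
  rw [← dist_pos, dist_circlePoint_of_le hR.le hε h.le h'.le]
  have := sin_pos_of_pos_of_lt_pi (sub_pos.2 h) (by linarith)
  positivity

/-- For a point between `β` and `γ`, the six-point conic is a pair of lines. -/
lemma exists_isSixPointConicOf (hR : 0 < R) (hε : ε ^ 2 = 1) (h₁ : α < β) (h₂ : β < γ)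
    (h₃ : γ < α + π) {θ : ℝ} (hβθ : β < θ) (hθγ : θ < γ) :
    ∃ Y₀ : Set Plane, IsLinePair Y₀ ∧
      (∀ X, IsCenter Y₀ X ↔ X = centerCurve (circlePoint O R ε) α β γ θ) ∧
      ∀ Y, IsSixPointConicOf (circlePoint O R ε α) (circlePoint O R ε β) (circlePoint O R ε γ)
        (circlePoint O R ε θ) Y ↔ Y = Y₀ := by
  obtain ⟨p, q, t, hq, hpq, ht, hpt, hq0, ht0, dBC, dCA, dAB, wA, wB, wC⟩ :=
    exists_halfAngle_params (O := O) hR hε h₁ h₂ h₃ hβθ.le hθγ.le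
  have hq : 0 < q := lt_of_le_of_ne hq fun h => hβθ.ne' (hq0.1 h.symm)
  have ht : 0 < t := lt_of_le_of_ne ht fun h => hθγ.ne (ht0.1 h.symm)
  have hp : 0 < p := hq.trans hpq
  have hqt : q * t < 1 := (mul_lt_mul_of_pos_right hpq ht).trans hpt
  have n₁ : 1 - q * t ≠ 0 := by linarith
  have n₂ : 1 - p * t ≠ 0 := by linarith
  have n₃ : p - q ≠ 0 := by linarith
  have hD := cross_circlePoint_ne_zero (O := O) hR hε h₁ h₂ h₃
  obtain ⟨Y₀, hY₀, hc, hY⟩ := exists_sixPointConic hD hq hpq ht hpt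
  refine ⟨Y₀, hY₀, fun X => ?_, fun Y => ?_⟩
  · rw [hc, centerCurve, wA, wB, wC]
  · rw [← hY, IsSixPointConicOf,
      vertices_eq (circlePoint_ne hR hε h₂ (by linarith)).symm
        (one_lt_one_add_div_one_sub (mul_pos hq ht) hqt) dBC,
      vertices_eq (circlePoint_ne hR hε (h₁.trans h₂) h₃)
        (one_lt_one_add_div_one_sub (mul_pos hp ht) hpt) dCA,
      vertices_eq (circlePoint_ne hR hε h₁ (by linarith)).symm
        (one_lt_add_div_sub hq hpq) dAB]
    have a₁ : (1 + (1 + q * t) / (1 - q * t)) / 2 = 1 / (1 - q * t) := by field_simp; ring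
    have a₂ : (1 - (1 + q * t) / (1 - q * t)) / 2 = -(q * t) / (1 - q * t) := by field_simp; ring
    have b₁ : (1 + (1 + p * t) / (1 - p * t)) / 2 = 1 / (1 - p * t) := by field_simp; ring
    have b₂ : (1 - (1 + p * t) / (1 - p * t)) / 2 = -(p * t) / (1 - p * t) := by field_simp; ring
    have c₁ : (1 + (p + q) / (p - q)) / 2 = p / (p - q) := by field_simp; ring
    have c₂ : (1 - (p + q) / (p - q)) / 2 = -q / (p - q) := by field_simp; ring
    simp only [Set.insert_subset_iff, Set.singleton_subset_iff, a₁, a₂, b₁, b₂, c₁, c₂, zero_smul,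
      zero_add, add_zero]
    rw [add_comm ((1 / (1 - p * t)) • circlePoint O R ε γ),
      add_comm ((-(p * t) / (1 - p * t)) • circlePoint O R ε γ)]
    tauto

/-- At `θ = β` one has `q = 0`, the coordinate at `B` vanishes, and the center lands on `CA`. The
explicit form with `k > 1` records that it is the vertex beyond `A`. -/
lemma centerCurve_left (hR : 0 < R) (hε : ε ^ 2 = 1) (h₁ : α < β) (h₂ : β < γ)
    (h₃ : γ < α + π) :
    ∃ k : ℝ, 1 < k ∧ centerCurve (circlePoint O R ε) α β γ β =
        ((1 - k) / 2) • circlePoint O R ε γ + ((1 + k) / 2) • circlePoint O R ε α ∧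
      centerCurve (circlePoint O R ε) α β γ β ∈
        vertices (circlePoint O R ε γ) (circlePoint O R ε α) (circlePoint O R ε β) := by
  obtain ⟨p, q, t, hq, hpq, ht, hpt, hq0, ht0, -, dCA, -, wA, wB, wC⟩ :=
    exists_halfAngle_params (O := O) hR hε h₁ h₂ h₃ le_rfl h₂.le
  obtain rfl : q = 0 := hq0.2 rfl
  have ht : 0 < t := lt_of_le_of_ne ht fun h => h₂.ne (ht0.1 h.symm)
  have n₂ : 1 - p * t ≠ 0 := by linarith
  have hk := one_lt_one_add_div_one_sub (mul_pos hpq ht) hpt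
  have e : centerCurve (circlePoint O R ε) α β γ β =
      ((1 - (1 + p * t) / (1 - p * t)) / 2) • circlePoint O R ε γ +
        ((1 + (1 + p * t) / (1 - p * t)) / 2) • circlePoint O R ε α := by
    have b₁ : (1 + (1 + p * t) / (1 - p * t)) / 2 = 1 / (1 - p * t) := by field_simp; ring
    have b₂ : (1 - (1 + p * t) / (1 - p * t)) / 2 = -(p * t) / (1 - p * t) := by field_simp; ring
    have hp : p ≠ 0 := hpq.ne'
    have c₁ : p * (1 - 0 ^ 2 * t ^ 2) / ((p - 0) * (1 - p * t) * (1 - 0 * t)) =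
        1 / (1 - p * t) := by
      simp only [sub_zero, zero_mul]
      field_simp
      ring
    have c₂ : -t * (p ^ 2 - 0 ^ 2) / ((p - 0) * (1 - p * t) * (1 - 0 * t)) =
        -(p * t) / (1 - p * t) := by
      simp only [sub_zero, zero_mul]
      field_simp
      ring
    rw [centerCurve, wA, wB, wC, b₁, b₂, c₁, c₂, neg_zero, zero_mul, zero_div, zero_smul, add_zero,
      add_comm]
  refine ⟨_, hk, e, ?_⟩
  rw [vertices_eq (circlePoint_ne hR hε (h₁.trans h₂) h₃) hk dCA, e]
  exact Or.inr rfl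

/-- At `θ = γ` one has `t = 0`, and the center is the vertex on `AB` beyond `A`. -/
lemma centerCurve_right (hR : 0 < R) (hε : ε ^ 2 = 1) (h₁ : α < β) (h₂ : β < γ)
    (h₃ : γ < α + π) :
    ∃ k : ℝ, 1 < k ∧ centerCurve (circlePoint O R ε) α β γ γ =
        ((1 + k) / 2) • circlePoint O R ε α + ((1 - k) / 2) • circlePoint O R ε β ∧
      centerCurve (circlePoint O R ε) α β γ γ ∈
        vertices (circlePoint O R ε α) (circlePoint O R ε β) (circlePoint O R ε γ) := by
  obtain ⟨p, q, t, hq, hpq, ht, hpt, hq0, ht0, -, -, dAB, wA, wB, wC⟩ :=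
    exists_halfAngle_params (O := O) hR hε h₁ h₂ h₃ h₂.le le_rfl
  obtain rfl : t = 0 := ht0.2 rfl
  have hq : 0 < q := lt_of_le_of_ne hq fun h => h₂.ne' (hq0.1 h.symm)
  have n₃ : p - q ≠ 0 := by linarith
  have hk := one_lt_add_div_sub hq hpq
  have e : centerCurve (circlePoint O R ε) α β γ γ =
      ((1 + (p + q) / (p - q)) / 2) • circlePoint O R ε α +
        ((1 - (p + q) / (p - q)) / 2) • circlePoint O R ε β := by
    have b₁ : (1 + (p + q) / (p - q)) / 2 = p / (p - q) := by field_simp; ring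
    have b₂ : (1 - (p + q) / (p - q)) / 2 = -q / (p - q) := by field_simp; ring
    rw [centerCurve, wA, wB, wC, b₁, b₂]
    simp
  refine ⟨_, hk, e, ?_⟩
  rw [vertices_eq (circlePoint_ne hR hε h₁ (by linarith)).symm hk dAB, e]
  exact Or.inl rfl

lemma centerCurve_shift (K : ℝ → Plane) (hK : ∀ θ, K (θ + π) = K θ) (α β γ θ : ℝ) :
    centerCurve K (α + π) (β + π) (γ + π) (θ + π) = centerCurve K α β γ θ := by
  simp only [centerCurve, weightA, weightB, weightC, weightSum, hK, add_sub_add_right_eq_sub]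

lemma range_centerCurve_shift (K : ℝ → Plane) (hK : ∀ θ, K (θ + π) = K θ) (α β γ : ℝ) :
    Set.range (centerCurve K (α + π) (β + π) (γ + π)) = Set.range (centerCurve K α β γ) := by
  ext X
  constructor
  · rintro ⟨θ, rfl⟩
    refine ⟨θ - π, ?_⟩
    rw [← centerCurve_shift K hK, sub_add_cancel]
  · rintro ⟨θ, rfl⟩
    exact ⟨θ + π, centerCurve_shift K hK α β γ θ⟩

/-- The curves of centers for different sides of the triangle are different. -/
lemma range_centerCurve_ne (hR : 0 < R) (hε : ε ^ 2 = 1) (h₁ : α < β) (h₂ : β < γ)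
    (h₃ : γ < α + π) :
    Set.range (centerCurve (circlePoint O R ε) α β γ) ≠
      Set.range (centerCurve (circlePoint O R ε) β γ (α + π)) := by
  intro heq
  have hS := (weightSum_pos h₁ h₂ h₃).ne'
  have hD := cross_circlePoint_ne_zero (O := O) hR hε h₁ h₂ h₃
  have hs : 0 < sin (β - α) := sin_pos_of_pos_of_lt_pi (by linarith) (by linarith)
  -- At parameter `γ` the second curve is at the vertex on `AB` beyond `B`. The first curve meets
  -- `AB` only in the midpoint and in the vertex beyond `A`.
  obtain ⟨k, hk, e, -⟩ := centerCurve_left (O := O) hR hε h₂ h₃ (by linarith)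
  obtain ⟨k', hk', e', -⟩ := centerCurve_right (O := O) hR hε h₁ h₂ h₃
  rw [circlePoint_add_pi] at e
  obtain ⟨θ, hθ⟩ : centerCurve (circlePoint O R ε) β γ (α + π) γ ∈
      Set.range (centerCurve (circlePoint O R ε) α β γ) := by
    rw [heq]
    exact ⟨_, rfl⟩
  rw [e] at hθ
  have hx : (1 + k) / 2 = 1 - (1 - k) / 2 := by ring
  have hθ' := hθ
  rw [hx] at hθ'
  rcases centerCurve_eq_on_side hS hD hs.ne' hθ' with h | h
  · linarith
  · rw [hθ, e'] at h
    have := barycentric_injective hD (w := 0) (w' := 0) (by ring) (congrArg (· + (0 : ℝ) •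
      circlePoint O R ε γ) h)
    linarith [this.1]

end Circle

/-! ### The triangle on its circumcircle -/

lemma exists_circlePoint_triangle (T : Affine.Triangle ℝ Plane) :
    ∃ (O : Plane) (R ε α β γ : ℝ), 0 < R ∧ ε ^ 2 = 1 ∧ α < β ∧ β < γ ∧ γ < α + π ∧
      T.points 0 = circlePoint O R ε α ∧ T.points 1 = circlePoint O R ε β ∧
      T.points 2 = circlePoint O R ε γ ∧ ∀ P, P ∈ T.circumsphere ↔ dist P O = R := by
  have hR : 0 < T.circumradius := T.circumradius_pos
  have hd := T.dist_circumcenter_eq_circumradius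
  obtain ⟨α, -, -, hα⟩ := exists_eq_circlePoint hR (one_pow 2) (hd 0) 0
  obtain ⟨β, hβ₁, hβ₂, hβ⟩ := exists_eq_circlePoint hR (one_pow 2) (hd 1) α
  obtain ⟨γ, hγ₁, hγ₂, hγ⟩ := exists_eq_circlePoint hR (one_pow 2) (hd 2) α
  have hinj := T.independent.injective
  have n₁ : α < β := by
    refine lt_of_le_of_ne hβ₁ ?_
    rintro rfl
    exact absurd (hinj (hα.trans hβ.symm)) (by decide)
  have n₂ : α < γ := by
    refine lt_of_le_of_ne hγ₁ ?_
    rintro rfl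
    exact absurd (hinj (hα.trans hγ.symm)) (by decide)
  have n₃ : β ≠ γ := by
    rintro rfl
    exact absurd (hinj (hβ.trans hγ.symm)) (by decide)
  rcases lt_or_gt_of_ne n₃ with h | h
  · exact ⟨_, _, 1, α, β, γ, hR, one_pow 2, n₁, h, hγ₂, hα, hβ, hγ,
      fun P => EuclideanGeometry.mem_sphere⟩
  -- For the opposite orientation, negate all parameters and move those of the last two vertices by
  -- `π` to restore the order.
  · refine ⟨T.circumcenter, T.circumradius, -1, -α, -β + π, -γ + π, hR, by norm_num, by linarith, by linarith, by linarith,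
      ?_, ?_, ?_, fun P => EuclideanGeometry.mem_sphere⟩
    · rw [circlePoint_neg, hα]
    · rw [circlePoint_add_pi, circlePoint_neg, hβ]
    · rw [circlePoint_add_pi, circlePoint_neg, hγ]

lemma dist_circlePoint_center {O : Plane} {R ε : ℝ} (hR : 0 ≤ R) (hε : ε ^ 2 = 1) (θ : ℝ) :
    dist (circlePoint O R ε θ) O = R := by
  rw [← sq_eq_sq₀ dist_nonneg hR, dist_sq_plane, circlePoint_zero, circlePoint_one]
  linear_combination R ^ 2 * sin_sq_add_cos_sq (2 * θ) + R ^ 2 * sin (2 * θ) ^ 2 * hε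

lemma isSixPointConic_iff (T : Affine.Triangle ℝ Plane) (P : Plane) (Y : Set Plane) :
    IsSixPointConic T P Y ↔ IsSixPointConicOf (T.points 0) (T.points 1) (T.points 2) P Y := by
  rw [IsSixPointConic, IsSixPointConicOf, Fin.forall_fin_succ, Fin.forall_fin_two]
  rfl

end ConicTriad

end

/-! ### Assembly of the three arcs -/

theorem mainTheorem5 (T : Affine.Triangle ℝ Plane) :
    -- the six-point conic and its center are well defined, and the conic is degenerate
    (∀ P ∈ admissible T, (∃! Y, IsSixPointConic T P Y) ∧
      ∀ Y, IsSixPointConic T P Y → IsLinePair Y ∧ ∃! O, IsCenter Y O) ∧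
    -- the locus of the center
    ∃ L Γ : Fin 3 → Set Plane,
      (∀ i, IsEllipse (L i)) ∧
      Function.Injective L ∧
      (∀ i j : Fin 3, midpoint ℝ (T.points (j + 1)) (T.points (j + 2)) ∈ L i) ∧
      (∀ i : Fin 3, ∃ U ∈ vEllipseVertices T (i + 1), ∃ W ∈ vEllipseVertices T (i + 2),
        IsArc (L i) U W (Γ i)) ∧
      centerLocus T = ⋃ i, Γ i := by
  open Real in
  obtain ⟨O, R, ε, α, β, γ, hR, hε, h₁, h₂, h₃, hA, hB, hC, hsph⟩ := exists_circlePoint_triangle T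
  have h₄ : α + π < β + π := by linarith
  have h₅ : β + π < γ + π := by linarith
  set K := circlePoint O R ε with hK
  have hKπ : ∀ θ, K (θ + π) = K θ := circlePoint_add_pi O R ε
  set c : Fin 3 → ℝ → Plane := ![centerCurve K α β γ, centerCurve K β γ (α + π),
    centerCurve K γ (α + π) (β + π)] with hc
  set s : Fin 3 → Set ℝ := ![Set.Ioo β γ, Set.Ioo γ (α + π), Set.Ioo (α + π) (β + π)] with hs
  have hS₀ := (weightSum_pos h₁ h₂ h₃).ne'
  have hS₁ := (weightSum_pos h₂ h₃ h₄).ne'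
  have hS₂ := (weightSum_pos h₃ h₄ h₅).ne'
  have hD₀ := cross_circlePoint_ne_zero (O := O) hR hε h₁ h₂ h₃
  have hD₁ := cross_circlePoint_ne_zero (O := O) hR hε h₂ h₃ h₄
  have hD₂ := cross_circlePoint_ne_zero (O := O) hR hε h₃ h₄ h₅
  have conic : ∀ i, ∀ θ ∈ s i, ∃ Y₀ : Set Plane, IsLinePair Y₀ ∧
      (∀ X, IsCenter Y₀ X ↔ X = c i θ) ∧ ∀ Y, IsSixPointConic T (K θ) Y ↔ Y = Y₀ := by
    intro i θ hθ
    simp only [isSixPointConic_iff, hA, hB, hC]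
    fin_cases i
    · exact exists_isSixPointConicOf hR hε h₁ h₂ h₃ hθ.1 hθ.2
    · have := exists_isSixPointConicOf (O := O) hR hε h₂ h₃ h₄ hθ.1 hθ.2
      rw [← hK, hKπ] at this
      simp only [isSixPointConicOf_rotate (A := K α)] at this
      exact this
    · have := exists_isSixPointConicOf (O := O) hR hε h₃ h₄ h₅ hθ.1 hθ.2
      rw [← hK, hKπ, hKπ] at this
      simp only [isSixPointConicOf_rotate (A := K β), isSixPointConicOf_rotate (A := K α)] at this
      exact this
  have param : ∀ P, P ∈ admissible T ↔ ∃ i, ∃ θ ∈ s i, P = K θ := by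
    have hrange : ∀ P, P ∈ Set.range T.points ↔ P = K α ∨ P = K β ∨ P = K γ := by
      intro P
      rw [← hA, ← hB, ← hC, Set.mem_range, Fin.exists_fin_succ, Fin.exists_fin_two]
      simp only [eq_comm (a := P)]
      rfl
    intro P
    simp only [admissible, Set.mem_ofPred_eq, hsph, hrange, not_or]
    constructor
    · rintro ⟨hP, hPA, hPB, hPC⟩
      -- Starting the period at `β` splits it at `γ` and `α + π` into exactly the three intervals `s
      -- i`.
      obtain ⟨θ, hθ₁, hθ₂, rfl⟩ := exists_eq_circlePoint hR hε hP β
      have nB : θ ≠ β := by rintro rfl; exact hPB rfl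
      have nC : θ ≠ γ := by rintro rfl; exact hPC rfl
      have nA : θ ≠ α + π := by rintro rfl; exact hPA (hKπ α)
      rcases lt_or_gt_of_ne nC with h | h
      · exact ⟨0, θ, ⟨lt_of_le_of_ne hθ₁ nB.symm, h⟩, rfl⟩
      rcases lt_or_gt_of_ne nA with h' | h'
      · exact ⟨1, θ, ⟨h, h'⟩, rfl⟩
      · exact ⟨2, θ, ⟨h', hθ₂⟩, rfl⟩
    · rintro ⟨i, θ, hθ, rfl⟩
      refine ⟨dist_circlePoint_center hR.le hε θ, ?_⟩
      fin_cases i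
      · obtain ⟨g₁, g₂⟩ : β < θ ∧ θ < γ := hθ
        exact ⟨circlePoint_ne hR hε (by linarith) (by linarith),
          circlePoint_ne hR hε (by linarith) (by linarith),
          (circlePoint_ne hR hε (by linarith) (by linarith)).symm⟩
      · obtain ⟨g₁, g₂⟩ : γ < θ ∧ θ < α + π := hθ
        exact ⟨circlePoint_ne hR hε (by linarith) (by linarith),
          circlePoint_ne hR hε (by linarith) (by linarith),
          circlePoint_ne hR hε (by linarith) (by linarith)⟩
      · obtain ⟨g₁, g₂⟩ : α + π < θ ∧ θ < β + π := hθ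
        rw [← hKπ α]
        exact ⟨circlePoint_ne hR hε (by linarith) (by linarith),
          circlePoint_ne hR hε (by linarith) (by linarith),
          circlePoint_ne hR hε (by linarith) (by linarith)⟩
  refine ⟨?_, fun i => Set.range (c i), fun i => c i '' s i, ?_, ?_, ?_, ?_, ?_⟩
  · intro P hP
    obtain ⟨i, θ, hθ, rfl⟩ := (param P).1 hP
    obtain ⟨Y₀, hY₀, hcen, hY⟩ := conic i θ hθ
    refine ⟨⟨Y₀, (hY Y₀).2 rfl, fun Y h => (hY Y).1 h⟩, fun Y h => ?_⟩
    obtain rfl := (hY Y).1 h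
    exact ⟨hY₀, c i θ, (hcen _).2 rfl, fun X hX => (hcen X).1 hX⟩
  · intro i
    fin_cases i
    · exact isEllipse_range_centerCurve hS₀ hD₀
    · exact isEllipse_range_centerCurve hS₁ hD₁
    · exact isEllipse_range_centerCurve hS₂ hD₂
  · have n₀ : Set.range (c 0) ≠ Set.range (c 1) := range_centerCurve_ne hR hε h₁ h₂ h₃
    have n₁ : Set.range (c 1) ≠ Set.range (c 2) := range_centerCurve_ne hR hε h₂ h₃ h₄
    have n₂ : Set.range (c 2) ≠ Set.range (c 0) := by
      -- The third cyclic shift moves all parameters by `π`, which returns the first curve.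
      have := range_centerCurve_ne (O := O) hR hε h₃ h₄ h₅
      rwa [range_centerCurve_shift _ hKπ] at this
    intro i j hij
    fin_cases i <;> fin_cases j <;>
      first | rfl | exact absurd hij n₀ | exact absurd hij n₁ | exact absurd hij n₂ |
        exact absurd hij.symm n₀ | exact absurd hij.symm n₁ | exact absurd hij.symm n₂
  · have mid : ∀ i, midpoint ℝ (T.points 1) (T.points 2) ∈ Set.range (c i) ∧
        midpoint ℝ (T.points 2) (T.points 0) ∈ Set.range (c i) ∧
        midpoint ℝ (T.points 0) (T.points 1) ∈ Set.range (c i) := by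
      intro i
      rw [hA, hB, hC]
      fin_cases i
      · exact ⟨midpoint_BC_mem hS₀, midpoint_CA_mem hS₀, midpoint_AB_mem hS₀⟩
      · have m₁ := midpoint_AB_mem (K := K) hS₁
        have m₂ := midpoint_BC_mem (K := K) hS₁
        have m₃ := midpoint_CA_mem (K := K) hS₁
        rw [hKπ] at m₂ m₃
        exact ⟨m₁, m₂, m₃⟩
      · have m₁ := midpoint_AB_mem (K := K) hS₂
        have m₂ := midpoint_BC_mem (K := K) hS₂
        have m₃ := midpoint_CA_mem (K := K) hS₂
        simp only [hKπ] at m₁ m₂ m₃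
        exact ⟨m₃, m₁, m₂⟩
    intro i j
    fin_cases j
    · exact (mid i).1
    · exact (mid i).2.1
    · exact (mid i).2.2
  · have v₀ : vEllipseVertices T 0 = vertices (K β) (K γ) (K α) := by
      rw [← hA, ← hB, ← hC]; rfl
    have v₁ : vEllipseVertices T 1 = vertices (K γ) (K α) (K β) := by
      rw [← hA, ← hB, ← hC]; rfl
    have v₂ : vEllipseVertices T 2 = vertices (K α) (K β) (K γ) := by
      rw [← hA, ← hB, ← hC]; rfl
    intro i
    fin_cases i
    · obtain ⟨_, -, -, hU⟩ := centerCurve_left (O := O) hR hε h₁ h₂ h₃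
      obtain ⟨_, -, -, hW⟩ := centerCurve_right (O := O) hR hε h₁ h₂ h₃
      exact ⟨_, v₁ ▸ hU, _, v₂ ▸ hW, isArc_centerCurve hS₀ hD₀ h₂ (by linarith)⟩
    · obtain ⟨_, -, -, hU⟩ := centerCurve_left (O := O) hR hε h₂ h₃ h₄
      obtain ⟨_, -, -, hW⟩ := centerCurve_right (O := O) hR hε h₂ h₃ h₄
      rw [← hK, hKπ, ← v₂] at hU
      rw [← hK, hKπ, ← v₀] at hW
      exact ⟨_, hU, _, hW, isArc_centerCurve hS₁ hD₁ h₃ (by linarith)⟩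
    · obtain ⟨_, -, -, hU⟩ := centerCurve_left (O := O) hR hε h₃ h₄ h₅
      obtain ⟨_, -, -, hW⟩ := centerCurve_right (O := O) hR hε h₃ h₄ h₅
      rw [← hK, hKπ, hKπ, ← v₀] at hU
      rw [← hK, hKπ, hKπ, ← v₁] at hW
      exact ⟨_, hU, _, hW, isArc_centerCurve hS₂ hD₂ h₄ (by linarith)⟩
  · ext X
    simp only [centerLocus, Set.mem_ofPred_eq, Set.mem_iUnion]
    constructor
    · rintro ⟨P, hP, Y, hY, hX⟩
      obtain ⟨i, θ, hθ, rfl⟩ := (param P).1 hP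
      obtain ⟨Y₀, -, hcen, hY'⟩ := conic i θ hθ
      obtain rfl := (hY' Y).1 hY
      exact ⟨i, θ, hθ, ((hcen X).1 hX).symm⟩
    · rintro ⟨i, θ, hθ, rfl⟩
      obtain ⟨Y₀, -, hcen, hY'⟩ := conic i θ hθ
      exact ⟨K θ, (param _).2 ⟨i, θ, hθ, rfl⟩, Y₀, (hY' Y₀).2 rfl, (hcen _).2 rfl⟩
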